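/- Let $(M,F)$ be an oriented closed Finsler surface: $F>0$ is smooth on $TM_0=TM\setminus 0$, positively homogeneous of degree one on the fibres, with positive definite $g_{ij}=\tfrac12[F^2]_{y^iy^j}$. Let $\pi:SM=TM_0/\mathbb R^+\to M$ be the projective sphere bundle. The fundamental tensor $g$ is a Euclidean metric on $\pi^*TM\to SM$, with distinguished unit section $l=y/F$. Put $A_{ijk}=\tfrac14F[F^2]_{y^iy^jy^k}$, $G^i=\tfrac14g^{ij}\left([F^2]_{y^jx^k}y^k-[F^2]_{x^j}\right)$ and $\delta y^i=\tfrac1F\left(dy^i+\frac{\partial G^i}{\partial y^j}dx^j\right)$. Let $\widetilde\nabla$ be the Chern connection on $\pi^*TM$, i.e. the smooth connection that is torsion free, $\widetilde\nabla_X(d\pi Y)-\widetilde\nabla_Y(d\pi X)=d\pi[X,Y]$ for vector fields $X,Y$ on $SM$, and almost metric, $(\widetilde\nabla_Xg)(U,V)=2A(U,V,\delta y(X))$ for sections $U,V$ of $\pi^*TM$. Let $H=\tfrac12(\widetilde\nabla^*-\widetilde\nabla)$, where $\widetilde\nabla^*$ is the connection dual to $\widetilde\nabla$ with respect to $g$;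 this is a one-form on $SM$ with values in $\mathrm{End}(\pi^*TM)$, and $\widehat\nabla=\widetilde\nabla+H$ is the Cartan connection. Let $\nabla_t=(1-t)\widetilde\nabla+t\widehat\nabla=\widetilde\nabla+tH$ for $t\in[0,1]$, with curvature $R_t=\nabla_t^2$, and let $\eta=\mathrm{tr}[H]\in\Omega^1(SM)$ be the Cartan form. Then, as three-forms on $SM$, $$-2\int_0^1\mathrm{tr}[H R_t]\,dt=\eta\wedge d\eta .$$ Moreover $\eta=H_{111}\,\omega^3$ for every local $g$-orthonormal frame $(e_1,e_2=l)$ of $\pi^*TM$. Here $\omega^1,\omega^2$ are the forms $\omega^i=v^i_j\,dx^j$ on $SM$ given by the dual coframe, $\omega^3=-v^1_j\,\delta y^j$, $(\mathbf e_1,\mathbf e_2,\mathbf e_3)$ is the frame of $T(SM)$ dual to $(\omega^1,\omega^2,\omega^3)$, and $H_{111}=g(H(\mathbf e_3)e_1,e_1)$. -/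

import Mathlib

open Set Bundle
open scoped Manifold ContDiff Topology

noncomputable section

/-- The model plane `ℝ²`. -/
abbrev Plane : Type := EuclideanSpace ℝ (Fin 2)

/-- Rotation of the plane by a right angle. -/
def planeRot (v : Plane) : Plane := !₂[-v 1, v 0]

section SphereBundle

variable {M : Type*} [TopologicalSpace M] [ChartedSpace Plane M] [IsManifold (𝓡 2) ∞ M]

variable (M) in
/-- The projective sphere bundle `SM = TM₀ / ℝ⁺` of a surface: a point of `SM` is a point `x` of `M`
together with a ray in `T_x M`, i.e. a nonzero tangent vector up to positive factors. -/
@[ext]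
structure SphereBundle where
  /-- the base point -/
  base : M
  /-- the ray of tangent vectors -/
  dir : Module.Ray ℝ (TangentSpace (𝓡 2) base)

/-- The components `(y¹, y²)` of a tangent vector `y ∈ T_x M` in the preferred chart at `x₀`. -/
def tangentCoord (x₀ x : M) : TangentSpace (𝓡 2) x →L[ℝ] Plane :=
  (trivializationAt Plane (TangentSpace (𝓡 2)) x₀).continuousLinearMapAt ℝ x

/-- The tangent vector at `x` with given components in the preferred chart at `x₀`. -/
def tangentCoordSymm (x₀ x : M) : Plane →L[ℝ] TangentSpace (𝓡 2) x :=
  (trivializationAt Plane (TangentSpace (𝓡 2)) x₀).symmL ℝ x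

lemma tangentCoordSymm_tangentCoord {x₀ x : M} (h : x ∈ (chartAt Plane x₀).source)
    (y : TangentSpace (𝓡 2) x) : tangentCoordSymm x₀ x (tangentCoord x₀ x y) = y :=
  (trivializationAt Plane (TangentSpace (𝓡 2)) x₀).symmL_continuousLinearMapAt (R := ℝ)
    (by simpa using h) y

lemma tangentCoord_tangentCoordSymm {x₀ x : M} (h : x ∈ (chartAt Plane x₀).source)
    (y : Plane) : tangentCoord x₀ x (tangentCoordSymm x₀ x y) = y :=
  (trivializationAt Plane (TangentSpace (𝓡 2)) x₀).continuousLinearMapAt_symmL (R := ℝ)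
    (by simpa using h) y

lemma inner_planeRot_self (v : Plane) : inner ℝ v (planeRot v) = 0 := by
  simp [planeRot, PiLp.inner_apply, Fin.sum_univ_two]; ring

lemma inner_add_smul_planeRot (v : Plane) (s : ℝ) :
    inner ℝ v (v + s • planeRot v) = ‖v‖ ^ 2 := by
  rw [inner_add_right, inner_smul_right, inner_planeRot_self]; simp

lemma inner_rot_add_smul_planeRot (v : Plane) (s : ℝ) :
    inner ℝ (planeRot v) (v + s • planeRot v) = s * ‖v‖ ^ 2 := by
  simp [planeRot, PiLp.inner_apply, Fin.sum_univ_two, EuclideanSpace.norm_sq_eq]; ring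

lemma add_smul_planeRot_ne_zero {v : Plane} (hv : v ≠ 0) (s : ℝ) : v + s • planeRot v ≠ 0 := by
  intro h
  have := inner_add_smul_planeRot v s
  rw [h, inner_zero_right] at this
  exact hv (by simpa using this.symm)

lemma plane_decomp (v w : Plane) :
    ‖v‖ ^ 2 • w = (inner ℝ v w : ℝ) • v + (inner ℝ (planeRot v) w : ℝ) • planeRot v := by
  ext i
  fin_cases i <;>
    simp [planeRot, PiLp.inner_apply, Fin.sum_univ_two, EuclideanSpace.norm_sq_eq] <;> ring

/-- Two rays through nonzero vectors have representatives that are positive multiples. -/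
lemma exists_pos_smul_someVector {V : Type*} [AddCommGroup V] [Module ℝ V] (y : V) (hy : y ≠ 0) :
    ∃ r : ℝ, 0 < r ∧ (rayOfNeZero ℝ y hy).someVector = r • y := by
  have h := (ray_eq_iff _ hy).1 (rayOfNeZero ℝ y hy).someVector_ray
  obtain ⟨r, hr, h⟩ := h.symm.exists_pos_left hy (Module.Ray.someVector_ne_zero _)
  exact ⟨r, hr, h.symm⟩

open Classical in
/-- The ray in `T_x M` through the tangent vector with components `w` in the preferred chart at `x₀`
(with an irrelevant value if `x` is outside of the domain of that chart). -/
def rayOfCoord (x₀ x : M) (w : Plane) (hw : w ≠ 0) : Module.Ray ℝ (TangentSpace (𝓡 2) x) :=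
  if h : tangentCoordSymm x₀ x w ≠ 0 then rayOfNeZero ℝ _ h
  else rayOfNeZero ℝ (show TangentSpace (𝓡 2) x from w) hw

lemma tangentCoordSymm_ne_zero {x₀ x : M} (h : x ∈ (chartAt Plane x₀).source) {w : Plane}
    (hw : w ≠ 0) : tangentCoordSymm x₀ x w ≠ 0 := by
  intro h0
  have := tangentCoord_tangentCoordSymm h w
  rw [h0, map_zero] at this
  exact hw this.symm

lemma exists_someVector_rayOfCoord {x₀ x : M} (h : x ∈ (chartAt Plane x₀).source) {w : Plane}
    (hw : w ≠ 0) : ∃ r : ℝ, 0 < r ∧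
      (rayOfCoord x₀ x w hw).someVector = r • tangentCoordSymm x₀ x w := by
  have h0 := tangentCoordSymm_ne_zero h hw
  rw [rayOfCoord, dif_pos h0]
  exact exists_pos_smul_someVector _ h0

lemma rayOfCoord_eq {x₀ x : M} (h : x ∈ (chartAt Plane x₀).source)
    (d : Module.Ray ℝ (TangentSpace (𝓡 2) x)) {r : ℝ} (hr : 0 < r) {w : Plane} (hw : w ≠ 0)
    (hd : tangentCoord x₀ x d.someVector = r • w) : rayOfCoord x₀ x w hw = d := by
  have h0 := tangentCoordSymm_ne_zero h hw
  rw [rayOfCoord, dif_pos h0, ← d.someVector_ray, ray_eq_iff]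
  have : d.someVector = r • tangentCoordSymm x₀ x w := by
    rw [← map_smul, ← hd, tangentCoordSymm_tangentCoord h]
  rw [this]
  exact SameRay.sameRay_pos_smul_right _ hr

/-- The slope of the direction `w` relative to `v₀`. -/
def slopeRel (v₀ w : Plane) : ℝ := inner ℝ (planeRot v₀) w / inner ℝ v₀ w

lemma slopeRel_smul (v₀ w : Plane) {r : ℝ} (hr : 0 < r) :
    slopeRel v₀ (r • w) = slopeRel v₀ w := by
  simp only [slopeRel, inner_smul_right]
  exact mul_div_mul_left _ _ hr.ne'

/-- The chart of `SM` given by the preferred chart of `M` at `x₀` and a nonzero vector `v₀ ∈ ℝ²`.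
It is defined at the `(x, [y])` with `x` in the domain of the chart of `M` and `⟨v₀, y⟩ > 0` (in
components); its inverse is `(u, s) ↦ [y]`, where `y` is the tangent vector at the point with
coordinates `u` that has the components `v₀ + s J v₀`, with `J` the rotation by a right angle. -/
def SphereBundle.chart (x₀ : M) (v₀ : {v : Plane // v ≠ 0}) :
    PartialEquiv (SphereBundle M) (Plane × ℝ) where
  toFun p := (chartAt Plane x₀ p.base, slopeRel v₀ (tangentCoord x₀ p.base p.dir.someVector))
  invFun z := ⟨(chartAt Plane x₀).symm z.1,
    rayOfCoord x₀ _ (v₀.1 + z.2 • planeRot v₀) (add_smul_planeRot_ne_zero v₀.2 z.2)⟩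
  source := {p | p.base ∈ (chartAt Plane x₀).source ∧
    0 < inner ℝ v₀.1 (tangentCoord x₀ p.base p.dir.someVector)}
  target := (chartAt Plane x₀).target ×ˢ univ
  map_source' p hp := ⟨(chartAt Plane x₀).map_source hp.1, mem_univ _⟩
  map_target' z hz := by
    have hx := (chartAt Plane x₀).map_target hz.1
    refine ⟨hx, ?_⟩
    obtain ⟨r, hr, h⟩ := exists_someVector_rayOfCoord hx (add_smul_planeRot_ne_zero v₀.2 z.2)
    dsimp only
    rw [h, map_smul, tangentCoord_tangentCoordSymm hx, inner_smul_right, inner_add_smul_planeRot]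
    have := norm_pos_iff.2 v₀.2
    positivity
  left_inv' p hp := by
    obtain ⟨x, d⟩ := p
    obtain ⟨hx, hpos⟩ := hp
    dsimp only at hx hpos ⊢
    have hd : tangentCoord x₀ x d.someVector =
        (inner ℝ v₀.1 (tangentCoord x₀ x d.someVector) / ‖v₀.1‖ ^ 2) •
          (v₀.1 + slopeRel v₀ (tangentCoord x₀ x d.someVector) • planeRot v₀) := by
      have hn : ‖v₀.1‖ ^ 2 ≠ 0 := by simpa using v₀.2
      have := plane_decomp v₀.1 (tangentCoord x₀ x d.someVector)
      rw [smul_add, smul_smul, slopeRel, div_mul_div_comm, mul_comm (inner ℝ v₀.1 _),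
        mul_div_mul_right _ _ hpos.ne', div_eq_inv_mul, div_eq_inv_mul, mul_smul, mul_smul,
        ← smul_add, ← this, smul_smul, inv_mul_cancel₀ hn, one_smul]
    have key : ∀ x', x' = x → (⟨x', rayOfCoord x₀ x'
        (v₀.1 + slopeRel v₀ (tangentCoord x₀ x d.someVector) • planeRot v₀)
        (add_smul_planeRot_ne_zero v₀.2 _)⟩ : SphereBundle M) = ⟨x, d⟩ := by
      rintro x' rfl
      congr 1
      exact rayOfCoord_eq hx d (div_pos hpos (by have := norm_pos_iff.2 v₀.2; positivity)) _ hd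
    exact key _ ((chartAt Plane x₀).left_inv hx)
  right_inv' z hz := by
    have hx := (chartAt Plane x₀).map_target hz.1
    obtain ⟨r, hr, h⟩ := exists_someVector_rayOfCoord hx (add_smul_planeRot_ne_zero v₀.2 z.2)
    have hn : ‖v₀.1‖ ^ 2 ≠ 0 := by simpa using v₀.2
    refine Prod.ext ((chartAt Plane x₀).right_inv hz.1) ?_
    dsimp only
    rw [h, map_smul, tangentCoord_tangentCoordSymm hx, slopeRel_smul _ _ hr, slopeRel,
      inner_add_smul_planeRot, inner_rot_add_smul_planeRot, mul_div_cancel_right₀ _ hn]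

/-- The matrix of the change of components of tangent vectors at the point with coordinates `u`. -/
def coordChangeDeriv (x₀ x₁ : M) (u : Plane) : Plane →L[ℝ] Plane :=
  fderiv ℝ (chartAt Plane x₁ ∘ (chartAt Plane x₀).symm) u

lemma tangentCoord_comp {x₀ x₁ x : M} (h₀ : x ∈ (chartAt Plane x₀).source)
    (h₁ : x ∈ (chartAt Plane x₁).source) (w : Plane) :
    tangentCoord x₁ x (tangentCoordSymm x₀ x w) =
      coordChangeDeriv x₀ x₁ (chartAt Plane x₀ x) w := by
  rw [tangentCoord, tangentCoordSymm,
    TangentBundle.continuousLinearMapAt_trivializationAt_eq_core h₁,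
    TangentBundle.symmL_trivializationAt_eq_core h₀]
  have := (tangentBundleCore (𝓡 2) M).coordChange_comp (achart Plane x₀) (achart Plane x)
    (achart Plane x₁) x ⟨⟨h₀, mem_chart_source _ _⟩, h₁⟩ w
  refine this.trans ?_
  rw [tangentBundleCore_coordChange_achart, coordChangeDeriv]
  simp [fderivWithin_univ]

lemma contDiffOn_coordChange (x₀ x₁ : M) :
    ContDiffOn ℝ ∞ (chartAt Plane x₁ ∘ (chartAt Plane x₀).symm)
      ((chartAt Plane x₀).symm ≫ₕ chartAt Plane x₁).source := by
  simpa [extChartAt] using contDiffOn_ext_coord_change (I := 𝓡 2) (n := ∞) x₁ x₀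

lemma contDiffOn_coordChangeDeriv (x₀ x₁ : M) :
    ContDiffOn ℝ ∞ (coordChangeDeriv x₀ x₁)
      ((chartAt Plane x₀).symm ≫ₕ chartAt Plane x₁).source := by
  refine (contDiffOn_coordChange x₀ x₁).fderiv_of_isOpen
    ((chartAt Plane x₀).symm ≫ₕ chartAt Plane x₁).open_source ?_
  simp

/-- The components in the second chart of the direction with coordinates `z` in the first. -/
def transDir (x₀ x₁ : M) (v₀ : {v : Plane // v ≠ 0}) (z : Plane × ℝ) : Plane :=
  coordChangeDeriv x₀ x₁ z.1 (v₀.1 + z.2 • planeRot v₀)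

lemma contDiffOn_transDir (x₀ x₁ : M) (v₀ : {v : Plane // v ≠ 0}) :
    ContDiffOn ℝ ∞ (transDir x₀ x₁ v₀)
      (((chartAt Plane x₀).symm ≫ₕ chartAt Plane x₁).source ×ˢ univ) := by
  unfold transDir
  refine ContDiffOn.clm_apply ((contDiffOn_coordChangeDeriv x₀ x₁).comp contDiffOn_fst
    (fun z hz => hz.1)) ?_
  exact ContDiff.contDiffOn (by fun_prop)

lemma SphereBundle.tangentCoord_chart_symm (x₀ x₁ : M) (v₀ : {v : Plane // v ≠ 0})
    {z : Plane × ℝ} (hz : z.1 ∈ ((chartAt Plane x₀).symm ≫ₕ chartAt Plane x₁).source) :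
    ∃ r : ℝ, 0 < r ∧
      tangentCoord x₁ ((chartAt Plane x₀).symm z.1)
        ((SphereBundle.chart x₀ v₀).symm z).dir.someVector = r • transDir x₀ x₁ v₀ z := by
  have h₀ : z.1 ∈ (chartAt Plane x₀).target := by
    have := hz; simp at this; exact this.1
  have h₁ : (chartAt Plane x₀).symm z.1 ∈ (chartAt Plane x₁).source := by
    have := hz; simp at this; exact this.2
  have hx := (chartAt Plane x₀).map_target h₀
  obtain ⟨r, hr, h⟩ := exists_someVector_rayOfCoord hx (add_smul_planeRot_ne_zero v₀.2 z.2)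
  refine ⟨r, hr, ?_⟩
  have e : tangentCoord x₁ ((chartAt Plane x₀).symm z.1)
      ((SphereBundle.chart x₀ v₀).symm z).dir.someVector = tangentCoord x₁ _ (rayOfCoord x₀ _
        (v₀.1 + z.2 • planeRot v₀) (add_smul_planeRot_ne_zero v₀.2 z.2)).someVector := rfl
  rw [e, h, map_smul, tangentCoord_comp hx h₁, (chartAt Plane x₀).right_inv h₀]
  rfl

lemma SphereBundle.trans_source (x₀ x₁ : M) (v₀ v₁ : {v : Plane // v ≠ 0}) :
    ((SphereBundle.chart x₀ v₀).symm.trans (SphereBundle.chart x₁ v₁)).source =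
      (((chartAt Plane x₀).symm ≫ₕ chartAt Plane x₁).source ×ˢ univ) ∩
        {z | 0 < inner ℝ v₁.1 (transDir x₀ x₁ v₀ z)} := by
  ext z
  have key : z.1 ∈ ((chartAt Plane x₀).symm ≫ₕ chartAt Plane x₁).source →
      (0 < inner ℝ v₁.1 (tangentCoord x₁ ((chartAt Plane x₀).symm z.1)
        ((SphereBundle.chart x₀ v₀).symm z).dir.someVector) ↔
        0 < inner ℝ v₁.1 (transDir x₀ x₁ v₀ z)) := by
    intro hz
    obtain ⟨r, hr, h⟩ := SphereBundle.tangentCoord_chart_symm x₀ x₁ v₀ hz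
    rw [h, inner_smul_right]
    exact mul_pos_iff_of_pos_left hr
  constructor
  · rintro ⟨h₀, h₁, hpos⟩
    have hz : z.1 ∈ ((chartAt Plane x₀).symm ≫ₕ chartAt Plane x₁).source := by
      rw [OpenPartialHomeomorph.trans_source]; exact ⟨h₀.1, h₁⟩
    exact ⟨⟨hz, mem_univ _⟩, (key hz).1 hpos⟩
  · rintro ⟨⟨hz, -⟩, hpos⟩
    have hz' := hz
    rw [OpenPartialHomeomorph.trans_source] at hz'
    exact ⟨⟨hz'.1, mem_univ _⟩, hz'.2, (key hz).2 hpos⟩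

lemma SphereBundle.trans_apply (x₀ x₁ : M) (v₀ v₁ : {v : Plane // v ≠ 0}) {z : Plane × ℝ}
    (hz : z.1 ∈ ((chartAt Plane x₀).symm ≫ₕ chartAt Plane x₁).source) :
    (SphereBundle.chart x₀ v₀).symm.trans (SphereBundle.chart x₁ v₁) z =
      ((chartAt Plane x₁ ∘ (chartAt Plane x₀).symm) z.1, slopeRel v₁ (transDir x₀ x₁ v₀ z)) := by
  obtain ⟨r, hr, h⟩ := SphereBundle.tangentCoord_chart_symm x₀ x₁ v₀ hz
  refine Prod.ext rfl ?_
  refine Eq.trans ?_ (slopeRel_smul v₁ _ hr)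
  rw [← h]
  rfl

lemma SphereBundle.contDiffOn_trans (x₀ x₁ : M) (v₀ v₁ : {v : Plane // v ≠ 0}) :
    ContDiffOn ℝ ∞ ((SphereBundle.chart x₀ v₀).symm.trans (SphereBundle.chart x₁ v₁))
      ((SphereBundle.chart x₀ v₀).symm.trans (SphereBundle.chart x₁ v₁)).source := by
  rw [SphereBundle.trans_source]
  have hT := (contDiffOn_transDir x₀ x₁ v₀).mono (inter_subset_left
    (t := {z | 0 < inner ℝ v₁.1 (transDir x₀ x₁ v₀ z)}))
  have : ContDiffOn ℝ ∞ (fun z : Plane × ℝ =>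
      ((chartAt Plane x₁ ∘ (chartAt Plane x₀).symm) z.1, slopeRel v₁ (transDir x₀ x₁ v₀ z)))
      ((((chartAt Plane x₀).symm ≫ₕ chartAt Plane x₁).source ×ˢ univ) ∩
        {z | 0 < inner ℝ v₁.1 (transDir x₀ x₁ v₀ z)}) := by
    refine ContDiffOn.prodMk ((contDiffOn_coordChange x₀ x₁).comp contDiffOn_fst
      (fun z hz => hz.1.1)) ?_
    exact (contDiffOn_const.inner ℝ hT).div (contDiffOn_const.inner ℝ hT)
      (fun z hz => ne_of_gt hz.2)
  exact this.congr fun z hz => SphereBundle.trans_apply x₀ x₁ v₀ v₁ hz.1.1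

lemma tangentCoord_someVector_ne_zero (p : SphereBundle M) :
    tangentCoord p.base p.base p.dir.someVector ≠ 0 := by
  intro h
  apply p.dir.someVector_ne_zero
  have := tangentCoordSymm_tangentCoord (mem_chart_source Plane p.base) p.dir.someVector
  rw [h, map_zero] at this
  exact this.symm

variable (M) in
/-- The smooth atlas of `SM`. -/
def SphereBundle.chartedSpaceCore : ChartedSpaceCore (Plane × ℝ) (SphereBundle M) where
  atlas := range fun i : M × {v : Plane // v ≠ 0} => SphereBundle.chart i.1 i.2
  chartAt p := SphereBundle.chart p.base
    ⟨tangentCoord p.base p.base p.dir.someVector, tangentCoord_someVector_ne_zero p⟩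
  mem_chart_source p := ⟨mem_chart_source Plane p.base,
    real_inner_self_pos.2 (tangentCoord_someVector_ne_zero p)⟩
  chart_mem_atlas p := mem_range_self (f := fun i : M × {v : Plane // v ≠ 0} =>
    SphereBundle.chart i.1 i.2) (_, _)
  open_source := by
    rintro _ _ ⟨⟨x₀, v₀⟩, rfl⟩ ⟨⟨x₁, v₁⟩, rfl⟩
    dsimp only
    rw [SphereBundle.trans_source]
    have ho : IsOpen (((chartAt Plane x₀).symm ≫ₕ chartAt Plane x₁).source ×ˢ
      (univ : Set ℝ)) := ((chartAt Plane x₀).symm ≫ₕ chartAt Plane x₁).open_source.prod isOpen_univ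
    exact (continuousOn_const.inner (𝕜 := ℝ)
      (contDiffOn_transDir x₀ x₁ v₀).continuousOn).isOpen_inter_preimage ho isOpen_Ioi
  continuousOn_toFun := by
    rintro _ _ ⟨⟨x₀, v₀⟩, rfl⟩ ⟨⟨x₁, v₁⟩, rfl⟩
    exact (SphereBundle.contDiffOn_trans x₀ x₁ v₀ v₁).continuousOn

instance : TopologicalSpace (SphereBundle M) :=
  (SphereBundle.chartedSpaceCore M).toTopologicalSpace

instance : ChartedSpace (Plane × ℝ) (SphereBundle M) :=
  (SphereBundle.chartedSpaceCore M).toChartedSpace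

instance : IsManifold 𝓘(ℝ, Plane × ℝ) ∞ (SphereBundle M) := by
  apply isManifold_of_contDiffOn
  intro e e' he he'
  obtain ⟨_, he⟩ := mem_iUnion.1 he
  obtain ⟨⟨⟨x₀, v₀⟩, rfl⟩, rfl⟩ := mem_iUnion.1 he
  obtain ⟨_, he'⟩ := mem_iUnion.1 he'
  obtain ⟨⟨⟨x₁, v₁⟩, rfl⟩, rfl⟩ := mem_iUnion.1 he'
  simpa using! SphereBundle.contDiffOn_trans x₀ x₁ v₀ v₁

variable (M) in
/-- The projection `π : SM → M`, as a smooth map. -/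
def SphereBundle.proj : C^∞⟮𝓘(ℝ, Plane × ℝ), SphereBundle M; 𝓡 2, M⟯ where
  val := SphereBundle.base
  property := by
    intro p
    have h₁ : ContMDiffAt 𝓘(ℝ, Plane × ℝ) 𝓘(ℝ, Plane × ℝ) ∞ (chartAt (Plane × ℝ) p) p :=
      (contMDiffOn_chart (x := p)).contMDiffAt (chart_source_mem_nhds _ p)
    have h₂ : ContMDiffAt 𝓘(ℝ, Plane × ℝ) (𝓡 2) ∞ (fun z : Plane × ℝ => z.1)
      (chartAt (Plane × ℝ) p p) := contDiff_fst.contMDiff.contMDiffAt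
    have h₃ : ContMDiffAt (𝓡 2) (𝓡 2) ∞ (chartAt Plane p.base).symm
        (chartAt (Plane × ℝ) p p).1 :=
      (contMDiffOn_chart_symm (x := p.base)).contMDiffAt
        ((chartAt Plane p.base).open_target.mem_nhds (mem_chart_target Plane p.base))
    refine (ContMDiffAt.comp p h₃ (h₂.comp p h₁)).congr_of_eventuallyEq ?_
    filter_upwards [chart_source_mem_nhds (Plane × ℝ) p] with q hq
    exact ((chartAt Plane p.base).left_inv hq.1).symm

variable (M) in
/-- The pulled-back tangent bundle `π^*TM → SM`. -/
abbrev PullbackTM : SphereBundle M → Type :=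
  SphereBundle.proj M *ᵖ (TangentSpace (𝓡 2) : M → Type)

instance (p : SphereBundle M) : AddCommGroup (PullbackTM M p) :=
  inferInstanceAs (AddCommGroup (TangentSpace (𝓡 2) p.base))

instance (p : SphereBundle M) : IsTopologicalAddGroup (PullbackTM M p) :=
  inferInstanceAs (IsTopologicalAddGroup (TangentSpace (𝓡 2) p.base))

instance (p : SphereBundle M) : ContinuousSMul ℝ (PullbackTM M p) :=
  inferInstanceAs (ContinuousSMul ℝ (TangentSpace (𝓡 2) p.base))

/-- The standard basis of the fibre of `π^*TM` at `p`. -/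
def stdBasis (p : SphereBundle M) : Module.Basis (Fin 2) ℝ (PullbackTM M p) :=
  (EuclideanSpace.basisFun (Fin 2) ℝ).toBasis

/-- The coordinate functionals of `stdBasis`. -/
def stdCoord (p : SphereBundle M) (i : Fin 2) : PullbackTM M p →L[ℝ] ℝ :=
  (EuclideanSpace.proj i : Plane →L[ℝ] ℝ)

/-- The local smooth frame of `π^*TM` near `p` that extends the standard basis at `p` (it has
constant components in a local trivialization). -/
def localFrameAt (p : SphereBundle M) (i : Fin 2) : Π q : SphereBundle M, PullbackTM M q :=
  FiberBundle.extend Plane (stdBasis p i)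

end SphereBundle

section Finsler

variable {M : Type*} [TopologicalSpace M] [ChartedSpace Plane M] [IsManifold (𝓡 2) ∞ M]

/-- The fundamental tensor `g_y(u, v) = ½ ∂²(F²)/∂u∂v` on `T_x M`, at `y ∈ T_x M`, for a function
`F` on `TM`. -/
def fundamentalTensor (F : TangentBundle (𝓡 2) M → ℝ) (x : M) (y u : TangentSpace (𝓡 2) x) :
    TangentSpace (𝓡 2) x →L[ℝ] ℝ :=
  ((1 / 2 : ℝ) • fderiv ℝ (fun z : Plane =>
    fderiv ℝ (fun w : Plane => F ⟨x, w⟩ ^ 2) z u) y : Plane →L[ℝ] ℝ)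

variable (M) in
/-- A Finsler structure on the surface `M`: a positive function `F`, smooth on `TM₀ = TM \ 0`,
positively homogeneous of degree one on the fibres, with positive definite fundamental tensor. The
values of `F` on the zero section play no role. -/
structure FinslerStructure where
  /-- the Finsler function -/
  toFun : TangentBundle (𝓡 2) M → ℝ
  smooth : ContMDiffOn (𝓡 2).tangent 𝓘(ℝ) ∞ toFun {v | v.2 ≠ 0}
  pos : ∀ (x : M) (y : TangentSpace (𝓡 2) x), y ≠ 0 → 0 < toFun ⟨x, y⟩
  homogeneous : ∀ (x : M) (y : TangentSpace (𝓡 2) x), y ≠ 0 → ∀ r : ℝ, 0 < r →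
    toFun ⟨x, r • y⟩ = r * toFun ⟨x, y⟩
  posDef : ∀ (x : M) (y : TangentSpace (𝓡 2) x), y ≠ 0 → ∀ u : TangentSpace (𝓡 2) x, u ≠ 0 →
    0 < fundamentalTensor toFun x y u u

namespace FinslerStructure

variable (F : FinslerStructure M)

/-- The distinguished section `l(x, [y]) = y / F(x, y)` of `π^*TM`. -/
def unitVec (p : SphereBundle M) : PullbackTM M p :=
  (F.toFun ⟨p.base, p.dir.someVector⟩)⁻¹ • (show TangentSpace (𝓡 2) p.base from p.dir.someVector)

/-- The Euclidean metric of `π^*TM` given by the fundamental tensor (which is homogeneous of degree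
zero in `y`, so that it may be evaluated at `y = l`). -/
def metric (p : SphereBundle M) (u : PullbackTM M p) : PullbackTM M p →L[ℝ] ℝ :=
  fundamentalTensor F.toFun p.base (F.unitVec p) u

/-- The Cartan tensor `A_{ijk} = ¼ F [F²]_{y^i y^j y^k}`, i.e. `A(u, v, w) = ½ F ∂_w g(u, v)`,
evaluated at `y = l` (it is homogeneous of degree zero in `y`). -/
def cartanTensor (p : SphereBundle M) (u v w : PullbackTM M p) : ℝ :=
  (1 / 2) * F.toFun ⟨p.base, F.unitVec p⟩ *
    fderiv ℝ (fun z : Plane => fundamentalTensor F.toFun p.base z u v) (F.unitVec p) w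

/-- The function `F²` in the coordinates `(x, y)` of `TM` that come from the preferred chart of `M`
at `x₀`. -/
def sqCoord (x₀ : M) (z : Plane × Plane) : ℝ :=
  F.toFun ⟨(chartAt Plane x₀).symm z.1,
    tangentCoordSymm x₀ ((chartAt Plane x₀).symm z.1) z.2⟩ ^ 2

end FinslerStructure

/-- The partial derivative `∂f/∂x^i` of a function of `(x, y) ∈ ℝ² × ℝ²`. -/
def partialX (i : Fin 2) (f : Plane × Plane → ℝ) (z : Plane × Plane) : ℝ :=
  fderiv ℝ f z (EuclideanSpace.single i 1, 0)

/-- The partial derivative `∂f/∂y^i` of a function of `(x, y) ∈ ℝ² × ℝ²`. -/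
def partialY (i : Fin 2) (f : Plane × Plane → ℝ) (z : Plane × Plane) : ℝ :=
  fderiv ℝ f z (0, EuclideanSpace.single i 1)

namespace FinslerStructure

variable (F : FinslerStructure M)

/-- The matrix `g_{ij} = ½ [F²]_{y^i y^j}` in coordinates. -/
def metricMatrix (x₀ : M) (z : Plane × Plane) : Matrix (Fin 2) (Fin 2) ℝ :=
  Matrix.of fun i j => (1 / 2) * partialY j (partialY i (F.sqCoord x₀)) z

/-- The spray coefficients `G^i = ¼ g^{ij} ([F²]_{y^j x^k} y^k - [F²]_{x^j})` in coordinates. -/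
def sprayCoeff (x₀ : M) (i : Fin 2) (z : Plane × Plane) : ℝ :=
  (1 / 4) * ∑ j, (F.metricMatrix x₀ z)⁻¹ i j *
    (∑ k, partialX k (partialY j (F.sqCoord x₀)) z * z.2 k - partialX j (F.sqCoord x₀) z)

/-- The coefficients `∂G^i/∂y^j` of the nonlinear connection in coordinates. -/
def nonlinearCoeff (x₀ : M) (i j : Fin 2) (z : Plane × Plane) : ℝ :=
  partialY j (F.sprayCoeff x₀ i) z

/-- The coordinates `(x, y)` of the unit vector `l(q) ∈ TM` at a point `q` of `SM`. -/
def unitCoord (x₀ : M) (q : SphereBundle M) : Plane × Plane :=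
  (chartAt Plane x₀ q.base, tangentCoord x₀ q.base (F.unitVec q))

/-- The `π^*TM`-valued one-form `δy^i ⊗ ∂/∂x^i` on `SM`, where
`δy^i = (1/F) (dy^i + ∂G^i/∂y^j dx^j)`. The quotient `TM₀ → SM` is inverted by the section
`q ↦ l(q)`, along which `F = 1`; so on `SM` one has `δy^i = dl^i + ∂G^i/∂y^j(l) dx^j`. -/
def deltaY (p : SphereBundle M) (X : TangentSpace 𝓘(ℝ, Plane × ℝ) p) : PullbackTM M p :=
  let d : Plane × Plane := mvfderiv 𝓘(ℝ, Plane × ℝ) (F.unitCoord p.base) p X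
  tangentCoordSymm p.base p.base (WithLp.toLp 2 fun i =>
    d.2 i + ∑ j, F.nonlinearCoeff p.base i j (F.unitCoord p.base p) * d.1 j)

/-- For a unit vector `e₁ ⟂ l` in `π^*TM` the form `ω³ = J^*ω¹ = -g(e₁, δy)`, i.e.
`ω³ = -v¹_i δy^i` if `ω¹ = v¹_i dx^i` is dual to `e₁` in the coframe dual to `(e₁, l)`. -/
def omega3 (p : SphereBundle M) (e₁ : PullbackTM M p) (X : TangentSpace 𝓘(ℝ, Plane × ℝ) p) : ℝ :=
  -F.metric p e₁ (F.deltaY p X)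

end FinslerStructure

/-- The differential of the projection `SM → M`, as a map `T(SM) → π^*TM`; in a frame of `π^*TM`
its components are the forms `ϑ = (ω¹, ω²)` of the dual coframe. -/
def solder (p : SphereBundle M) : TangentSpace 𝓘(ℝ, Plane × ℝ) p →L[ℝ] PullbackTM M p :=
  mfderiv 𝓘(ℝ, Plane × ℝ) (𝓡 2) (SphereBundle.proj M) p

variable (M) in
/-- Linear connections on `π^*TM → SM`; `D σ p X` is `(∇_X σ)(p)`. -/
abbrev PullbackConnection := CovariantDerivative 𝓘(ℝ, Plane × ℝ) Plane (PullbackTM M)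

/-- The covariant derivative `(∇_X g)(U, V) = X g(U, V) - g(∇_X U, V) - g(U, ∇_X V)` at `p` of the
metric of `π^*TM`, for sections `U`, `V`, as a linear form in `X`. -/
def metricDeriv (F : FinslerStructure M) (D : PullbackConnection M)
    (U V : Π q : SphereBundle M, PullbackTM M q) (p : SphereBundle M) :
    TangentSpace 𝓘(ℝ, Plane × ℝ) p →L[ℝ] ℝ :=
  mvfderiv 𝓘(ℝ, Plane × ℝ) (fun q => F.metric q (U q) (V q)) p -
    (F.metric p (V p)).comp (D U p) - (F.metric p (U p)).comp (D V p)

/-- `D` is the Chern connection of `(M, F)`: the smooth connection on `π^*TM` that solves the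
structure equations `dϑ = ϑ ∧ ω`, `ω + ω^t = -2H`, where `H_{ij} = -A(e_i, e_j, e_γ) ω^{n+γ}`.
Without frames: `D` is torsion free, i.e. `∇_X(dπ Y) - ∇_Y(dπ X) = dπ[X, Y]`, and it is almost
metric, i.e. `(∇_X g)(U, V) = 2 A(U, V, δy(X))`. -/
structure IsChernConnection (F : FinslerStructure M) (D : PullbackConnection M) : Prop where
  smooth : ∀ s : Set (SphereBundle M), IsOpen s →
    ContMDiffCovariantDerivativeOn Plane ∞ D.toFun s
  torsion_free : ∀ (X Y : Π q : SphereBundle M, TangentSpace 𝓘(ℝ, Plane × ℝ) q)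
    (p : SphereBundle M),
    MDifferentiableAt 𝓘(ℝ, Plane × ℝ) 𝓘(ℝ, Plane × ℝ).tangent
      (fun q => (⟨q, X q⟩ : TangentBundle 𝓘(ℝ, Plane × ℝ) (SphereBundle M))) p →
    MDifferentiableAt 𝓘(ℝ, Plane × ℝ) 𝓘(ℝ, Plane × ℝ).tangent
      (fun q => (⟨q, Y q⟩ : TangentBundle 𝓘(ℝ, Plane × ℝ) (SphereBundle M))) p →
    D (fun q => solder q (Y q)) p (X p) - D (fun q => solder q (X q)) p (Y p) =
      solder p (VectorField.mlieBracket 𝓘(ℝ, Plane × ℝ) X Y p)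
  almost_metric : ∀ (U V : Π q : SphereBundle M, PullbackTM M q) (p : SphereBundle M),
    MDifferentiableAt 𝓘(ℝ, Plane × ℝ) (𝓘(ℝ, Plane × ℝ).prod 𝓘(ℝ, Plane))
      (fun q => (⟨q, U q⟩ : TotalSpace Plane (PullbackTM M))) p →
    MDifferentiableAt 𝓘(ℝ, Plane × ℝ) (𝓘(ℝ, Plane × ℝ).prod 𝓘(ℝ, Plane))
      (fun q => (⟨q, V q⟩ : TotalSpace Plane (PullbackTM M))) p →
    ∀ X : TangentSpace 𝓘(ℝ, Plane × ℝ) p,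
      metricDeriv F D U V p X = 2 * F.cartanTensor p (U p) (V p) (F.deltaY p X)

/-- The Cartan endomorphism `H`, a one-form on `SM` with values in the endomorphisms of `π^*TM`;
`cartanEndo F D p u X` is `H(X)u`. It is defined by `2H = ∇^* - ∇` with the dual connection `∇^*` of
`∇ = D`, given by `X g(U, V) = g(∇_X U, V) + g(U, ∇^*_X V)`. Thus `2 g(H(X)U, V) = (∇_X g)(U, V)`,
which is solved for `H` in a basis. -/
def cartanEndo (F : FinslerStructure M) (D : PullbackConnection M) (p : SphereBundle M) :
    PullbackTM M p →L[ℝ] TangentSpace 𝓘(ℝ, Plane × ℝ) p →L[ℝ] PullbackTM M p :=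
  ∑ i, ∑ j, ∑ k, (stdCoord p i).smulRight
    (((1 / 2 * (Matrix.of fun a b => F.metric p (stdBasis p a) (stdBasis p b))⁻¹ k j) •
      metricDeriv F D (localFrameAt p i) (localFrameAt p j) p).smulRight (stdBasis p k))

/-- The Cartan connection `∇̂ = ∇ + H`, where `∇ = D` is the Chern connection. -/
def cartanConnection (F : FinslerStructure M) (D : PullbackConnection M) : PullbackConnection M :=
  D.addOneForm (cartanEndo F D)

/-- The connections `∇_t = (1 - t) ∇ + t ∇̂ = ∇ + tH` between the Chern and Cartan connections. -/
def connectionPath (F : FinslerStructure M) (D : PullbackConnection M) (t : ℝ) :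
    PullbackConnection M :=
  D.affineCombination (cartanConnection F D) fun _ => 1 - t

/-- The curvature `R(X, Y)u = ∇_X ∇_Y u - ∇_Y ∇_X u - ∇_{[X, Y]} u` at `p`, an endomorphism of the
fibre of `π^*TM`. It is computed with local extensions of the tangent vectors `X`, `Y` and of the
standard basis of the fibre. -/
def curvature (D : PullbackConnection M) (p : SphereBundle M)
    (X Y : TangentSpace 𝓘(ℝ, Plane × ℝ) p) : PullbackTM M p →ₗ[ℝ] PullbackTM M p :=
  (stdBasis p).constr ℝ fun i =>
    let σ := localFrameAt p i
    let X' : Π q : SphereBundle M, TangentSpace 𝓘(ℝ, Plane × ℝ) q :=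
      FiberBundle.extend (Plane × ℝ) X
    let Y' : Π q : SphereBundle M, TangentSpace 𝓘(ℝ, Plane × ℝ) q :=
      FiberBundle.extend (Plane × ℝ) Y
    D (fun q => D σ q (Y' q)) p X - D (fun q => D σ q (X' q)) p Y -
      D σ p (VectorField.mlieBracket 𝓘(ℝ, Plane × ℝ) X' Y' p)

/-- The Cartan form `η = tr[H]`, a one-form on `SM` (the trace is taken in the standard basis). -/
def cartanForm (F : FinslerStructure M) (D : PullbackConnection M) (p : SphereBundle M) :
    TangentSpace 𝓘(ℝ, Plane × ℝ) p →L[ℝ] ℝ :=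
  ∑ i, (stdCoord p i).comp (cartanEndo F D p (stdBasis p i))

/-- The exterior derivative of a one-form `α` on `SM`, in the preferred chart `φ` at `p`:
`dα(X, Y) = X(α(Y)) - Y(α(X))` for the vector fields with constant components in that chart. -/
def extDerivOneForm (α : Π q : SphereBundle M, TangentSpace 𝓘(ℝ, Plane × ℝ) q →L[ℝ] ℝ)
    (p : SphereBundle M) (X Y : TangentSpace 𝓘(ℝ, Plane × ℝ) p) : ℝ :=
  let φ := extChartAt 𝓘(ℝ, Plane × ℝ) p
  let β : Plane × ℝ → Plane × ℝ →L[ℝ] ℝ := fun z =>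
    (α (φ.symm z)).comp (mfderiv 𝓘(ℝ, Plane × ℝ) 𝓘(ℝ, Plane × ℝ) φ.symm z)
  let X' : Plane × ℝ := mfderiv 𝓘(ℝ, Plane × ℝ) 𝓘(ℝ, Plane × ℝ) φ p X
  let Y' : Plane × ℝ := mfderiv 𝓘(ℝ, Plane × ℝ) 𝓘(ℝ, Plane × ℝ) φ p Y
  fderiv ℝ β (φ p) X' Y' - fderiv ℝ β (φ p) Y' X'

/-- The wedge product of a one-form and a two-form, evaluated at three vectors. -/
def wedgeOneTwo {V : Type*} (α : V → ℝ) (β : V → V → ℝ) (X Y Z : V) : ℝ :=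
  α X * β Y Z - α Y * β X Z + α Z * β X Y

/-- The endomorphism `H(X)` of the fibre of `π^*TM` at `p`. -/
def endoAt (p : SphereBundle M)
    (H : PullbackTM M p →L[ℝ] TangentSpace 𝓘(ℝ, Plane × ℝ) p →L[ℝ] PullbackTM M p)
    (X : TangentSpace 𝓘(ℝ, Plane × ℝ) p) : PullbackTM M p →ₗ[ℝ] PullbackTM M p where
  toFun u := H u X
  map_add' u v := by simp
  map_smul' r u := by simp

/-- The three-form `tr[H R]` on `SM`, for an endomorphism valued one-form `H` and an endomorphism
valued two-form `R` at a point `p` (wedge product of forms, composition of endomorphisms). -/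
def traceWedge (p : SphereBundle M)
    (H : PullbackTM M p →L[ℝ] TangentSpace 𝓘(ℝ, Plane × ℝ) p →L[ℝ] PullbackTM M p)
    (R : TangentSpace 𝓘(ℝ, Plane × ℝ) p → TangentSpace 𝓘(ℝ, Plane × ℝ) p →
      PullbackTM M p →ₗ[ℝ] PullbackTM M p)
    (X Y Z : TangentSpace 𝓘(ℝ, Plane × ℝ) p) : ℝ :=
  LinearMap.trace ℝ (PullbackTM M p)
    (endoAt p H X ∘ₗ R Y Z - endoAt p H Y ∘ₗ R X Z + endoAt p H Z ∘ₗ R X Y)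

end Finsler

end

/-! Everything rests on the rank of $H$. Since $F^2$ is homogeneous of degree two, its fibre Hessian
is homogeneous of degree zero, and Euler's relation shows that the totally symmetric Cartan tensor
$A$ vanishes when one argument is $l$. On a surface, a local orthonormal frame $(e, l)$ therefore
leaves one component, and $g(H(X)u, v) = A(u, v, \delta y(X))$ becomes $H(X)u = \eta(X)\, g(u, e)\,
e$ with $\eta(X) = A(e, e, \delta y(X))$ (`IsChernConnection.cartanEndo_eq`,
`IsChernConnection.cartanForm_eq`). By symmetry of $A$ the last slot also sees only the
$e$-component of $\delta y(X)$, which gives $\eta = -A_{111}\omega^3$; evaluating at $\mathbf e_3$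
identifies the coefficient with $H_{111}$.

Almost metricity, applied to the pairs $(e,e)$, $(e,l)$ and $(l,l)$, whose inner products are
constant, yields $\nabla e = -\eta\, e + \mu\, l$ and $\nabla l = -\mu\, e$ for the Chern connection
(`IsChernConnection.apply_frame`). Because $H e = \eta\, e$ and $H l = 0$, the connection $\nabla_t$
has the same shape with $-\eta$ replaced by $(t-1)\eta$. In the $(e,e)$-entry of the curvature the
quadratic terms are $\mu\wedge\mu$ and the square of a scalar one-form, both zero, so $g(R_t e, e) =
(t-1)\,d\eta$ (`metric_curvature_frame`).

As $H$ has rank one, $\mathrm{tr}[H R_t] = \eta\wedge g(R_t e, e) = (t-1)\,\eta\wedge d\eta$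
(`IsChernConnection.traceWedge_curvature`), and $-2\int_0^1 (t-1)\,dt = 1$. The remaining work is
analytic: smoothness of $l$, of $g$ and of the frame, and commuting coordinate fields in which
$d\eta$ and the curvature can be computed. -/

noncomputable section

/-! ### Euler's relations for positively homogeneous functions -/

section HomogeneousFunctions

variable {E G : Type*} [NormedAddCommGroup E] [NormedSpace ℝ E]
  [NormedAddCommGroup G] [NormedSpace ℝ G] {h : E → G} {k : ℕ}

/-- The derivative of a positively homogeneous function of degree `k + 1` is positively homogeneous
of degree `k`. -/
lemma fderiv_smul_of_homogeneous
    (hom : ∀ y : E, y ≠ 0 → ∀ r : ℝ, 0 < r → h (r • y) = r ^ (k + 1) • h y)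
    (hd : ∀ y : E, y ≠ 0 → DifferentiableAt ℝ h y) (y : E) (hy : y ≠ 0) (r : ℝ) (hr : 0 < r) :
    fderiv ℝ h (r • y) = r ^ k • fderiv ℝ h y := by
  have e : (fun z => h (r • z)) =ᶠ[𝓝 y] fun z => r ^ (k + 1) • h z := by
    filter_upwards [isOpen_ne.mem_nhds hy] with z hz using hom z hz r hr
  have h1 : HasFDerivAt (fun z => h (r • z)) (r • fderiv ℝ h (r • y)) y := by
    refine (((hd (r • y) (smul_ne_zero hr.ne' hy)).hasFDerivAt).comp y
      ((hasFDerivAt_id y).const_smul r)).congr_fderiv ?_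
    ext v
    simp
  have h2 : HasFDerivAt (fun z => r ^ (k + 1) • h z) (r ^ (k + 1) • fderiv ℝ h y) y :=
    (hd y hy).hasFDerivAt.const_smul _
  have := h1.unique (h2.congr_of_eventuallyEq e)
  rw [pow_succ', mul_smul] at this
  exact smul_right_injective _ hr.ne' this

/-- Euler's relation for positively homogeneous functions. -/
lemma fderiv_apply_self_of_homogeneous {y : E}
    (hom : ∀ r : ℝ, 0 < r → h (r • y) = r ^ k • h y)
    (hd : DifferentiableAt ℝ h y) : fderiv ℝ h y y = (k : ℝ) • h y := by
  -- The function $r \mapsto h(ry)$ is differentiated at $r = 1$ in two ways: by the chain rule and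
  -- through its power law.
  have h1 : HasDerivAt (fun r : ℝ => h (r • y)) (fderiv ℝ h y y) 1 := by
    have hd' : HasFDerivAt h (fderiv ℝ h y) ((1 : ℝ) • y) := by
      rw [one_smul]; exact hd.hasFDerivAt
    refine (hd'.comp_hasDerivAt (1 : ℝ) ((hasDerivAt_id (1 : ℝ)).smul_const y)).congr_deriv ?_
    simp
  have h2 : HasDerivAt (fun r : ℝ => r ^ k • h y) ((k : ℝ) • h y) 1 := by
    simpa using (hasDerivAt_pow k (1 : ℝ)).smul_const (h y)
  refine h1.unique (h2.congr_of_eventuallyEq ?_)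
  filter_upwards [isOpen_Ioi.mem_nhds (zero_lt_one : (0 : ℝ) < 1)] with r hr using hom r hr

end HomogeneousFunctions

/-! ### The function $F^2$ on a fibre, the fundamental tensor and the Cartan tensor -/

section Fibre

variable {M : Type*} [TopologicalSpace M] [ChartedSpace Plane M] [IsManifold (𝓡 2) ∞ M]

namespace FinslerStructure

variable (F : FinslerStructure M)

/-- The restriction of `F²` to the fibre `T_x M`. -/
def sqFibre (x : M) (w : Plane) : ℝ := F.toFun ⟨x, w⟩ ^ 2

/-- In coordinates $F^2$ is the square of $F$ composed with the inverse of a smooth trivialization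
of $TM$. The zero section is removed, as $F$ is smooth only off it. Smoothness of $F^2$ on fibres,
of $l$ and of $g$ all come from here. -/
lemma contDiffOn_sqCoord (x₀ : M) :
    ContDiffOn ℝ ∞ (F.sqCoord x₀) ((chartAt Plane x₀).target ×ˢ {0}ᶜ) := by
  rw [← contMDiffOn_iff_contDiffOn]
  have hs := (trivializationAt Plane (TangentSpace (𝓡 2) : M → Type) x₀).contMDiffOn_symm
    (n := ∞) (IB := 𝓡 2)
  have hφ : ContMDiffOn 𝓘(ℝ, Plane × Plane) ((𝓡 2).prod 𝓘(ℝ, Plane)) ∞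
      (fun z : Plane × Plane => ((chartAt Plane x₀).symm z.1, z.2))
      ((chartAt Plane x₀).target ×ˢ {0}ᶜ) := by
    refine ContMDiffOn.prodMk ?_ contDiff_snd.contMDiff.contMDiffOn
    exact (contMDiffOn_chart_symm (I := 𝓡 2) (n := ∞) (x := x₀)).comp
      contDiff_fst.contMDiff.contMDiffOn (fun z hz => hz.1)
  have key : ∀ z ∈ (chartAt Plane x₀).target ×ˢ ({0}ᶜ : Set Plane),
      (trivializationAt Plane (TangentSpace (𝓡 2) : M → Type) x₀).toOpenPartialHomeomorph.symm
        ((chartAt Plane x₀).symm z.1, z.2) = (⟨(chartAt Plane x₀).symm z.1,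
    tangentCoordSymm x₀ ((chartAt Plane x₀).symm z.1) z.2⟩ : TangentBundle (𝓡 2) M) := by
    intro z hz
    have hx := (chartAt Plane x₀).map_target hz.1
    rw [← Bundle.Trivialization.mk_symm]
    · rw [tangentCoordSymm, Bundle.Trivialization.symmL_apply _ (by simpa using hx)]
    · simpa using hx
  have hF := F.smooth.comp (hs.comp hφ (t := _) ?_) ?_
  · refine (hF.pow 2).congr ?_
    intro z hz
    simp only [sqCoord, Function.comp_apply, key z hz]
  · intro z hz
    rw [mem_preimage, Bundle.Trivialization.mem_target]
    simpa using (chartAt Plane x₀).map_target hz.1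
  · intro z hz
    rw [mem_preimage, Function.comp_apply, key z hz]
    exact tangentCoordSymm_ne_zero ((chartAt Plane x₀).map_target hz.1) hz.2

lemma sqFibre_eq {x₀ x : M} (h : x ∈ (chartAt Plane x₀).source) (w : TangentSpace (𝓡 2) x) :
    F.sqFibre x w = F.sqCoord x₀ (chartAt Plane x₀ x, tangentCoord x₀ x w) := by
  -- The point $\varphi^{-1}(\varphi(x))$ equals $x$ only propositionally, while the type of a
  -- tangent vector depends on its base point; so the base point is generalized first.
  have key : ∀ x', x' = x → F.sqFibre x w =
      F.toFun ⟨x', tangentCoordSymm x₀ x' (tangentCoord x₀ x w)⟩ ^ 2 := by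
    rintro _ rfl
    rw [tangentCoordSymm_tangentCoord h]
    rfl
  exact key _ ((chartAt Plane x₀).left_inv h)

lemma tangentCoord_ne_zero {x₀ x : M} (h : x ∈ (chartAt Plane x₀).source)
    {w : TangentSpace (𝓡 2) x} (hw : w ≠ 0) : tangentCoord x₀ x w ≠ 0 := by
  intro h0
  apply hw
  rw [← tangentCoordSymm_tangentCoord h w, h0, map_zero]

lemma contDiffAt_sqCoord {x₀ x : M} (h : x ∈ (chartAt Plane x₀).source) {y : Plane} (hy : y ≠ 0) :
    ContDiffAt ℝ ∞ (F.sqCoord x₀) (chartAt Plane x₀ x, y) :=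
  (F.contDiffOn_sqCoord x₀).contDiffAt
    (((chartAt Plane x₀).open_target.prod isOpen_compl_singleton).mem_nhds
      ⟨(chartAt Plane x₀).map_source h, hy⟩)

/-- The function `F²` on a fibre, in the coordinates of a chart. -/
lemma contDiffAt_sqCoord_snd {x₀ x : M} (h : x ∈ (chartAt Plane x₀).source) {y : Plane}
    (hy : y ≠ 0) : ContDiffAt ℝ ∞ (fun w => F.sqCoord x₀ (chartAt Plane x₀ x, w)) y :=
  (F.contDiffAt_sqCoord h hy).comp y (contDiffAt_const.prodMk contDiffAt_id)

lemma contDiffAt_sqFibre (x : M) {w : Plane} (hw : w ≠ 0) : ContDiffAt ℝ ∞ (F.sqFibre x) w := by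
  have hx := mem_chart_source Plane x
  let L : Plane →L[ℝ] Plane := tangentCoord x x
  have e : F.sqFibre x = (fun w => F.sqCoord x (chartAt Plane x x, w)) ∘ L :=
    funext fun w => F.sqFibre_eq hx w
  rw [e]
  exact (F.contDiffAt_sqCoord_snd hx (tangentCoord_ne_zero hx hw)).comp w L.contDiff.contDiffAt

/-- Rewriting $g_y$ as an iterated Fréchet derivative gives access to Schwarz symmetry and to the
homogeneity lemmas. -/
lemma fundamentalTensor_eq (x : M) {y : Plane} (hy : y ≠ 0) (u v : Plane) :
    fundamentalTensor F.toFun x y u v =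
      (1 / 2) * fderiv ℝ (fderiv ℝ (F.sqFibre x)) y v u := by
  have h2 : DifferentiableAt ℝ (fderiv ℝ (F.sqFibre x)) y :=
    ((F.contDiffAt_sqFibre x hy).fderiv_right (m := 1) (by norm_cast)).differentiableAt (by simp)
  have : fderiv ℝ (fun z : Plane => fderiv ℝ (F.sqFibre x) z u) y =
      (fderiv ℝ (fderiv ℝ (F.sqFibre x)) y).flip u := by
    rw [fderiv_clm_apply h2 (differentiableAt_const _)]
    ext
    simp
  change (1 / 2 : ℝ) • fderiv ℝ (fun z : Plane => fderiv ℝ (F.sqFibre x) z u) y v = _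
  rw [this]
  simp

lemma sqFibre_smul (x : M) (y : Plane) (hy : y ≠ 0) (r : ℝ) (hr : 0 < r) :
    F.sqFibre x (r • y) = r ^ (1 + 1) • F.sqFibre x y := by
  have := F.homogeneous x y hy r hr
  rw [sqFibre, sqFibre, smul_eq_mul, ← mul_pow]
  exact congrArg (· ^ 2) this

lemma differentiableAt_sqFibre (x : M) {y : Plane} (hy : y ≠ 0) :
    DifferentiableAt ℝ (F.sqFibre x) y :=
  (F.contDiffAt_sqFibre x hy).differentiableAt (by simp)

lemma contDiffAt_fderiv_sqFibre (x : M) {y : Plane} (hy : y ≠ 0) :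
    ContDiffAt ℝ ∞ (fderiv ℝ (F.sqFibre x)) y :=
  (F.contDiffAt_sqFibre x hy).fderiv_right (by norm_cast)

lemma contDiffAt_fderiv_fderiv_sqFibre (x : M) {y : Plane} (hy : y ≠ 0) :
    ContDiffAt ℝ ∞ (fderiv ℝ (fderiv ℝ (F.sqFibre x))) y :=
  (F.contDiffAt_fderiv_sqFibre x hy).fderiv_right (by norm_cast)

lemma fderiv_sqFibre_smul (x : M) (y : Plane) (hy : y ≠ 0) (r : ℝ) (hr : 0 < r) :
    fderiv ℝ (F.sqFibre x) (r • y) = r ^ (0 + 1) • fderiv ℝ (F.sqFibre x) y :=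
  fderiv_smul_of_homogeneous (F.sqFibre_smul x) (fun _ hy => F.differentiableAt_sqFibre x hy)
    y hy r hr

lemma fderiv_fderiv_sqFibre_smul (x : M) (y : Plane) (hy : y ≠ 0) (r : ℝ) (hr : 0 < r) :
    fderiv ℝ (fderiv ℝ (F.sqFibre x)) (r • y) = r ^ 0 • fderiv ℝ (fderiv ℝ (F.sqFibre x)) y :=
  fderiv_smul_of_homogeneous (F.fderiv_sqFibre_smul x)
    (fun _ hy => (F.contDiffAt_fderiv_sqFibre x hy).differentiableAt (by simp)) y hy r hr

/-- Euler's relation is used twice: for $D(F^2)$, of degree one, and for $F^2$, of degree two. At $y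
= l$ this makes $l$ a unit vector. -/
lemma fderiv_fderiv_sqFibre_self (x : M) {y : Plane} (hy : y ≠ 0) :
    fderiv ℝ (fderiv ℝ (F.sqFibre x)) y y y = 2 * F.sqFibre x y := by
  rw [fderiv_apply_self_of_homogeneous (fun r hr => F.fderiv_sqFibre_smul x y hy r hr)
    ((F.contDiffAt_fderiv_sqFibre x hy).differentiableAt (by simp))]
  simp [fderiv_apply_self_of_homogeneous (fun r hr => F.sqFibre_smul x y hy r hr)
    (F.differentiableAt_sqFibre x hy)]

/-- The Hessian has degree zero, so the factor in Euler's relation is $0$. This is the source of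
$A(l, \cdot, \cdot) = 0$. -/
lemma fderiv_fderiv_fderiv_sqFibre_self (x : M) {y : Plane} (hy : y ≠ 0) :
    fderiv ℝ (fderiv ℝ (fderiv ℝ (F.sqFibre x))) y y = 0 := by
  rw [fderiv_apply_self_of_homogeneous (fun r hr => F.fderiv_fderiv_sqFibre_smul x y hy r hr)
    ((F.contDiffAt_fderiv_fderiv_sqFibre x hy).differentiableAt (by simp))]
  simp

lemma fderiv_fderiv_sqFibre_comm (x : M) {y : Plane} (hy : y ≠ 0) (u v : Plane) :
    fderiv ℝ (fderiv ℝ (F.sqFibre x)) y u v = fderiv ℝ (fderiv ℝ (F.sqFibre x)) y v u :=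
  ((F.contDiffAt_sqFibre x hy).isSymmSndFDerivAt (by simp; norm_cast)) u v

/-- Schwarz symmetry for the map $D(F^2)$. With `fderiv_fderiv_fderiv_sqFibre_swap_right`, which
differentiates the symmetry of the Hessian, it generates all permutations of the arguments. -/
lemma fderiv_fderiv_fderiv_sqFibre_swap_left (x : M) {y : Plane} (hy : y ≠ 0) (u v w : Plane) :
    fderiv ℝ (fderiv ℝ (fderiv ℝ (F.sqFibre x))) y u v w =
      fderiv ℝ (fderiv ℝ (fderiv ℝ (F.sqFibre x))) y v u w := by
  rw [((F.contDiffAt_fderiv_sqFibre x hy).isSymmSndFDerivAt (by simp; norm_cast)) u v]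

lemma fderiv_fderiv_fderiv_sqFibre_swap_right (x : M) {y : Plane} (hy : y ≠ 0) (u v w : Plane) :
    fderiv ℝ (fderiv ℝ (fderiv ℝ (F.sqFibre x))) y u v w =
      fderiv ℝ (fderiv ℝ (fderiv ℝ (F.sqFibre x))) y u w v := by
  have hd : DifferentiableAt ℝ (fderiv ℝ (fderiv ℝ (F.sqFibre x))) y :=
    (F.contDiffAt_fderiv_fderiv_sqFibre x hy).differentiableAt (by simp)
  have key : ∀ a b : Plane, HasFDerivAt (fun z => fderiv ℝ (fderiv ℝ (F.sqFibre x)) z a b)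
      (((fderiv ℝ (fderiv ℝ (fderiv ℝ (F.sqFibre x))) y).flip a).flip b) y := by
    intro a b
    refine ((hd.hasFDerivAt.clm_apply (hasFDerivAt_const a y)).clm_apply
      (hasFDerivAt_const b y)).congr_fderiv ?_
    ext
    simp
  have e : (fun z => fderiv ℝ (fderiv ℝ (F.sqFibre x)) z v w) =ᶠ[𝓝 y]
      fun z => fderiv ℝ (fderiv ℝ (F.sqFibre x)) z w v := by
    filter_upwards [isOpen_ne.mem_nhds hy] with z hz using F.fderiv_fderiv_sqFibre_comm x hz v w
  exact congrArg (fun T : Plane →L[ℝ] ℝ => T u) ((key v w).unique ((key w v).congr_of_eventuallyEq e))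

lemma toFun_someVector_pos (p : SphereBundle M) : 0 < F.toFun ⟨p.base, p.dir.someVector⟩ :=
  F.pos _ _ p.dir.someVector_ne_zero

lemma unitVec_ne_zero (p : SphereBundle M) : F.unitVec p ≠ 0 :=
  smul_ne_zero (inv_ne_zero (F.toFun_someVector_pos p).ne') p.dir.someVector_ne_zero

lemma toFun_unitVec (p : SphereBundle M) : F.toFun ⟨p.base, F.unitVec p⟩ = 1 := by
  have h := F.toFun_someVector_pos p
  exact (F.homogeneous p.base _ p.dir.someVector_ne_zero _ (inv_pos.2 h)).trans
    (inv_mul_cancel₀ h.ne')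

/-- The second derivative of `F²` on a fibre. -/
def sqHessian (x : M) (y u v : Plane) : ℝ := fderiv ℝ (fderiv ℝ (F.sqFibre x)) y u v

/-- The third derivative of `F²` on a fibre. -/
def sqThirdDeriv (x : M) (y u v w : Plane) : ℝ :=
  fderiv ℝ (fderiv ℝ (fderiv ℝ (F.sqFibre x))) y u v w

lemma fderiv_fundamentalTensor (x : M) {y : Plane} (hy : y ≠ 0) (u v w : Plane) :
    fderiv ℝ (fun z : Plane => fundamentalTensor F.toFun x z u v) y w =
      (1 / 2) * F.sqThirdDeriv x y w v u := by
  have hd : DifferentiableAt ℝ (fderiv ℝ (fderiv ℝ (F.sqFibre x))) y :=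
    (F.contDiffAt_fderiv_fderiv_sqFibre x hy).differentiableAt (by simp)
  have e : (fun z : Plane => fundamentalTensor F.toFun x z u v) =ᶠ[𝓝 y]
      fun z => (1 / 2 : ℝ) * fderiv ℝ (fderiv ℝ (F.sqFibre x)) z v u := by
    filter_upwards [isOpen_ne.mem_nhds hy] with z hz using F.fundamentalTensor_eq x hz u v
  have h1 := ((hd.hasFDerivAt.clm_apply (hasFDerivAt_const v y)).clm_apply
      (hasFDerivAt_const u y)).const_mul (1 / 2 : ℝ)
  rw [(h1.congr_of_eventuallyEq e).fderiv]
  simp [sqThirdDeriv]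

lemma metric_eq (p : SphereBundle M) (u v : PullbackTM M p) :
    F.metric p u v = (1 / 2) * F.sqHessian p.base (F.unitVec p) v u :=
  F.fundamentalTensor_eq p.base (F.unitVec_ne_zero p) u v

lemma metric_comm (p : SphereBundle M) (u v : PullbackTM M p) :
    F.metric p u v = F.metric p v u := by
  rw [metric_eq, metric_eq]
  exact congrArg _ (F.fderiv_fderiv_sqFibre_comm p.base (F.unitVec_ne_zero p) _ _)

lemma metric_add_left (p : SphereBundle M) (u u' v : PullbackTM M p) :
    F.metric p (u + u') v = F.metric p u v + F.metric p u' v := by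
  rw [metric_comm, map_add, F.metric_comm p v, F.metric_comm p v]

lemma metric_smul_left (p : SphereBundle M) (r : ℝ) (u v : PullbackTM M p) :
    F.metric p (r • u) v = r * F.metric p u v := by
  rw [metric_comm, map_smul, F.metric_comm p v, smul_eq_mul]

lemma metric_pos (p : SphereBundle M) (u : PullbackTM M p) (hu : u ≠ 0) : 0 < F.metric p u u :=
  F.posDef p.base _ (F.unitVec_ne_zero p) u hu

lemma metric_unitVec_self (p : SphereBundle M) : F.metric p (F.unitVec p) (F.unitVec p) = 1 := by
  have h1 : F.sqHessian p.base (F.unitVec p) (F.unitVec p) (F.unitVec p) =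
      2 * F.toFun ⟨p.base, F.unitVec p⟩ ^ 2 :=
    F.fderiv_fderiv_sqFibre_self p.base (F.unitVec_ne_zero p)
  rw [metric_eq, h1, toFun_unitVec]
  norm_num

lemma cartanTensor_eq (p : SphereBundle M) (u v w : PullbackTM M p) :
    F.cartanTensor p u v w = (1 / 4) * F.sqThirdDeriv p.base (F.unitVec p) w v u := by
  have h : fderiv ℝ (fun z : Plane => fundamentalTensor F.toFun p.base z u v) (F.unitVec p) w =
      (1 / 2) * F.sqThirdDeriv p.base (F.unitVec p) w v u :=
    F.fderiv_fundamentalTensor p.base (F.unitVec_ne_zero p) u v w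
  rw [cartanTensor, toFun_unitVec, h]
  ring

lemma cartanTensor_swap_left (p : SphereBundle M) (u v w : PullbackTM M p) :
    F.cartanTensor p u v w = F.cartanTensor p v u w := by
  rw [cartanTensor_eq, cartanTensor_eq]
  exact congrArg _ (F.fderiv_fderiv_fderiv_sqFibre_swap_right p.base (F.unitVec_ne_zero p) _ _ _)

lemma cartanTensor_swap_right (p : SphereBundle M) (u v w : PullbackTM M p) :
    F.cartanTensor p u v w = F.cartanTensor p u w v := by
  rw [cartanTensor_eq, cartanTensor_eq]
  exact congrArg _ (F.fderiv_fderiv_fderiv_sqFibre_swap_left p.base (F.unitVec_ne_zero p) _ _ _)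

lemma cartanTensor_add_left (p : SphereBundle M) (u u' v w : PullbackTM M p) :
    F.cartanTensor p (u + u') v w = F.cartanTensor p u v w + F.cartanTensor p u' v w := by
  simp only [cartanTensor_eq, ← mul_add]
  exact congrArg _ (map_add _ (u : Plane) (u' : Plane))

lemma cartanTensor_smul_left (p : SphereBundle M) (r : ℝ) (u v w : PullbackTM M p) :
    F.cartanTensor p (r • u) v w = r * F.cartanTensor p u v w := by
  simp only [cartanTensor_eq, mul_left_comm r]
  exact congrArg _ (map_smul _ r (u : Plane))

/-- Euler's relation kills the slot of differentiation; total symmetry moves $l$ into that slot. -/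
lemma cartanTensor_unitVec_left (p : SphereBundle M) (v w : PullbackTM M p) :
    F.cartanTensor p (F.unitVec p) v w = 0 := by
  have h : F.sqThirdDeriv p.base (F.unitVec p) (F.unitVec p) w v = 0 := by
    have := F.fderiv_fderiv_fderiv_sqFibre_self p.base (F.unitVec_ne_zero p)
    exact congrArg (fun T : Plane →L[ℝ] Plane →L[ℝ] ℝ => T w v) this
  rw [cartanTensor_swap_left, cartanTensor_swap_right, cartanTensor_eq, h, mul_zero]

end FinslerStructure
end Fibre

/-! ### The Cartan endomorphism and the Cartan form in an orthonormal frame -/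

section CartanEndo

variable {M : Type*} [TopologicalSpace M] [ChartedSpace Plane M] [IsManifold (𝓡 2) ∞ M]

lemma sum_stdCoord_smul_stdBasis (p : SphereBundle M) (u : PullbackTM M p) :
    ∑ i, stdCoord p i u • stdBasis p i = u :=
  (stdBasis p).sum_repr u

lemma localFrameAt_self (p : SphereBundle M) (i : Fin 2) : localFrameAt p i p = stdBasis p i :=
  FiberBundle.extend_apply_self Plane _

lemma mdifferentiableAt_localFrameAt (p : SphereBundle M) (i : Fin 2) :
    MDifferentiableAt 𝓘(ℝ, Plane × ℝ) (𝓘(ℝ, Plane × ℝ).prod 𝓘(ℝ, Plane))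
      (fun q => (⟨q, localFrameAt p i q⟩ : TotalSpace Plane (PullbackTM M))) p :=
  FiberBundle.mdifferentiableAt_extend 𝓘(ℝ, Plane × ℝ) Plane (stdBasis p i)

namespace FinslerStructure

variable (F : FinslerStructure M) {p : SphereBundle M}

/-- Expansion in an orthonormal frame of the form `(e₁, l)`. -/
lemma eq_add_of_orthonormal {e₁ : PullbackTM M p} (h₁ : F.metric p e₁ e₁ = 1)
    (h₂ : F.metric p e₁ (F.unitVec p) = 0) (u : PullbackTM M p) :
    u = F.metric p u e₁ • e₁ + F.metric p u (F.unitVec p) • F.unitVec p := by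
  have h₃ := F.metric_unitVec_self p
  have h₄ : F.metric p (F.unitVec p) e₁ = 0 := by rw [metric_comm, h₂]
  have hli : LinearIndependent ℝ ![e₁, F.unitVec p] := by
    rw [LinearIndependent.pair_iff]
    intro s t h
    have a := congrArg (F.metric p e₁) h
    have b := congrArg (F.metric p (F.unitVec p)) h
    simp only [map_add, map_smul, h₁, h₂, h₃, h₄, map_zero, smul_eq_mul] at a b
    exact ⟨by linarith, by linarith⟩
  have hspan := hli.span_eq_top_of_card_eq_finrank
    (by rw [Module.finrank_eq_card_basis (stdBasis p)])
  have hu : u ∈ Submodule.span ℝ (Set.range ![e₁, F.unitVec p]) := by rw [hspan]; trivial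
  rw [Matrix.range_cons, Matrix.range_cons, Matrix.range_empty, union_empty,
    singleton_union, Submodule.mem_span_pair] at hu
  obtain ⟨a, b, rfl⟩ := hu
  simp only [metric_add_left, metric_smul_left, h₁, h₂, h₃, h₄]
  simp

lemma eq_of_metric_eq {u v : PullbackTM M p}
    (h : ∀ w, F.metric p u w = F.metric p v w) : u = v := by
  by_contra hne
  have := F.metric_pos p (u - v) (sub_ne_zero.2 hne)
  rw [F.metric_comm, map_sub, F.metric_comm p _ u, F.metric_comm p _ v, h, sub_self] at this
  exact this.false

/-- The Cartan tensor is determined by its component `A₁₁₁`. -/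
lemma cartanTensor_eq_of_orthonormal {e₁ : PullbackTM M p} (h₁ : F.metric p e₁ e₁ = 1)
    (h₂ : F.metric p e₁ (F.unitVec p) = 0) (u v w : PullbackTM M p) :
    F.cartanTensor p u v w = F.metric p u e₁ * F.metric p v e₁ * F.cartanTensor p e₁ e₁ w := by
  have h : ∀ u v w, F.cartanTensor p u v w = F.metric p u e₁ * F.cartanTensor p e₁ v w := by
    intro u v w
    conv_lhs => rw [F.eq_add_of_orthonormal h₁ h₂ u]
    rw [cartanTensor_add_left, cartanTensor_smul_left, cartanTensor_smul_left,
      cartanTensor_unitVec_left]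
    ring
  rw [h, cartanTensor_swap_left, h]
  ring

/-- The matrix of the metric in the standard basis. -/
def stdGram (p : SphereBundle M) : Matrix (Fin 2) (Fin 2) ℝ :=
  Matrix.of fun a b => F.metric p (stdBasis p a) (stdBasis p b)

/-- A kernel vector of the Gram matrix would be the component vector of some $u \neq 0$ with $g(u,u)
= 0$. -/
lemma isUnit_det_stdGram (p : SphereBundle M) : IsUnit (F.stdGram p).det := by
  rw [isUnit_iff_ne_zero]
  intro h
  obtain ⟨v, hv, h0⟩ := Matrix.exists_mulVec_eq_zero_iff.2 h
  have hne : ∑ i, v i • stdBasis p i ≠ 0 := by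
    intro h1
    exact hv (funext fun i => Fintype.linearIndependent_iff.1 (stdBasis p).linearIndependent v h1 i)
  have hpos := F.metric_pos p _ hne
  have h2 : F.metric p (∑ i, v i • stdBasis p i) (∑ i, v i • stdBasis p i) =
      ∑ i, v i * (F.stdGram p).mulVec v i := by
    simp only [Matrix.mulVec, dotProduct, stdGram, Matrix.of_apply, Fin.sum_univ_two,
      metric_add_left, metric_smul_left, map_add, map_smul, smul_eq_mul]
    ring
  rw [h2, h0] at hpos
  simp at hpos

end FinslerStructure

variable {F : FinslerStructure M} {D : PullbackConnection M}

lemma cartanEndo_apply (p : SphereBundle M) (u : PullbackTM M p)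
    (X : TangentSpace 𝓘(ℝ, Plane × ℝ) p) :
    cartanEndo F D p u X = ∑ i, ∑ j, ∑ k, (stdCoord p i u * (1 / 2 * (F.stdGram p)⁻¹ k j *
      metricDeriv F D (localFrameAt p i) (localFrameAt p j) p X)) • stdBasis p k := by
  simp only [cartanEndo, sum_apply, ContinuousLinearMap.smulRight_apply,
    smul_apply, smul_eq_mul, smul_smul]
  rfl

/-- The Cartan endomorphism of the Chern connection: `g(H(X)u, v) = A(u, v, δy(X))`. -/
lemma IsChernConnection.metric_cartanEndo (hD : IsChernConnection F D) (p : SphereBundle M)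
    (u v : PullbackTM M p) (X : TangentSpace 𝓘(ℝ, Plane × ℝ) p) :
    F.metric p (cartanEndo F D p u X) v = F.cartanTensor p u v (F.deltaY p X) := by
  have hinv : F.stdGram p * (F.stdGram p)⁻¹ = 1 :=
    Matrix.mul_nonsing_inv _ (F.isUnit_det_stdGram p)
  have hA : ∀ i j, metricDeriv F D (localFrameAt p i) (localFrameAt p j) p X =
      2 * F.cartanTensor p (stdBasis p i) (stdBasis p j) (F.deltaY p X) := by
    intro i j
    rw [hD.almost_metric _ _ p (mdifferentiableAt_localFrameAt p i)
      (mdifferentiableAt_localFrameAt p j), localFrameAt_self, localFrameAt_self]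
  -- Pairing with a basis vector multiplies the inverse Gram matrix in the definition of $H$ by the
  -- Gram matrix. The sum collapses to one term, and the factor $1/2$ cancels the $2$ of almost
  -- metricity.
  have hb : ∀ m, F.metric p (cartanEndo F D p u X) (stdBasis p m) =
      F.cartanTensor p u (stdBasis p m) (F.deltaY p X) := by
    intro m
    have e : ∀ j, ∑ k, F.metric p (stdBasis p m) (stdBasis p k) * (F.stdGram p)⁻¹ k j =
        (1 : Matrix (Fin 2) (Fin 2) ℝ) m j := fun j => congrFun (congrFun hinv m) j
    have hu : F.cartanTensor p u (stdBasis p m) (F.deltaY p X) = ∑ i, stdCoord p i u *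
        F.cartanTensor p (stdBasis p i) (stdBasis p m) (F.deltaY p X) := by
      conv_lhs => rw [← sum_stdCoord_smul_stdBasis p u]
      simp only [Fin.sum_univ_two, F.cartanTensor_add_left, F.cartanTensor_smul_left]
    rw [cartanEndo_apply, F.metric_comm, hu]
    simp only [map_sum, map_smul, smul_eq_mul, hA]
    refine Finset.sum_congr rfl fun i _ => ?_
    have hm : F.cartanTensor p (stdBasis p i) (stdBasis p m) (F.deltaY p X) =
        ∑ j, (1 : Matrix (Fin 2) (Fin 2) ℝ) m j *
          F.cartanTensor p (stdBasis p i) (stdBasis p j) (F.deltaY p X) := by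
      simp [Matrix.one_apply]
    rw [hm, Finset.mul_sum]
    refine Finset.sum_congr rfl fun j _ => ?_
    rw [← e, Finset.sum_mul, Finset.mul_sum]
    exact Finset.sum_congr rfl fun k _ => by ring
  have hv : F.cartanTensor p u v (F.deltaY p X) = ∑ i, stdCoord p i v *
      F.cartanTensor p u (stdBasis p i) (F.deltaY p X) := by
    rw [F.cartanTensor_swap_left]
    conv_lhs => rw [← sum_stdCoord_smul_stdBasis p v]
    simp only [Fin.sum_univ_two, F.cartanTensor_add_left, F.cartanTensor_smul_left,
      F.cartanTensor_swap_left p u]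
  conv_lhs => rw [← sum_stdCoord_smul_stdBasis p v]
  simp only [map_sum, map_smul, hb, smul_eq_mul, hv]

/-- Only the $e_1$-components of $u$ and $v$ contribute to $A(u, v, \cdot)$, so nondegeneracy of $g$
forces $H(X)$ to have image in the line of $e_1$ and to annihilate $l$. -/
lemma IsChernConnection.cartanEndo_eq (hD : IsChernConnection F D) {p : SphereBundle M}
    {e₁ : PullbackTM M p} (h₁ : F.metric p e₁ e₁ = 1)
    (h₂ : F.metric p e₁ (F.unitVec p) = 0) (u : PullbackTM M p)
    (X : TangentSpace 𝓘(ℝ, Plane × ℝ) p) :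
    cartanEndo F D p u X = (F.cartanTensor p e₁ e₁ (F.deltaY p X) * F.metric p u e₁) • e₁ := by
  refine F.eq_of_metric_eq fun w => ?_
  rw [hD.metric_cartanEndo, F.cartanTensor_eq_of_orthonormal h₁ h₂, F.metric_smul_left,
    F.metric_comm p w]
  ring

/-- The trace of $u \mapsto c\, g(u, e_1)\, e_1$ is $c\, g(e_1, e_1) = c$; the sum over the standard
basis is the expansion of $g(e_1, e_1)$. -/
lemma IsChernConnection.cartanForm_eq (hD : IsChernConnection F D) {p : SphereBundle M}
    {e₁ : PullbackTM M p} (h₁ : F.metric p e₁ e₁ = 1)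
    (h₂ : F.metric p e₁ (F.unitVec p) = 0) (X : TangentSpace 𝓘(ℝ, Plane × ℝ) p) :
    cartanForm F D p X = F.cartanTensor p e₁ e₁ (F.deltaY p X) := by
  have h : F.metric p e₁ e₁ = ∑ i, stdCoord p i e₁ * F.metric p (stdBasis p i) e₁ := by
    have := congrArg (F.metric p e₁) (sum_stdCoord_smul_stdBasis p e₁).symm
    simpa only [map_sum, map_smul, smul_eq_mul, F.metric_comm p e₁ (stdBasis p _)] using this
  rw [h₁] at h
  simp only [cartanForm, sum_apply, ContinuousLinearMap.comp_apply,
    hD.cartanEndo_eq h₁ h₂, map_smul, smul_eq_mul, mul_assoc, ← Finset.mul_sum]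
  simp only [mul_comm (F.metric p _ _), ← h, mul_one]

/-- By symmetry $\delta y(X)$ may be moved to a slot where only its $e_1$-component counts. The sign
is the one in $\omega^3 = -g(e_1, \delta y)$. -/
lemma IsChernConnection.cartanForm_eq_omega3 (hD : IsChernConnection F D) {p : SphereBundle M}
    {e₁ : PullbackTM M p} (h₁ : F.metric p e₁ e₁ = 1)
    (h₂ : F.metric p e₁ (F.unitVec p) = 0) (X : TangentSpace 𝓘(ℝ, Plane × ℝ) p) :
    cartanForm F D p X = -F.cartanTensor p e₁ e₁ e₁ * F.omega3 p e₁ X := by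
  rw [hD.cartanForm_eq h₁ h₂, F.cartanTensor_swap_right, F.cartanTensor_swap_left,
    F.cartanTensor_eq_of_orthonormal h₁ h₂, h₁, FinslerStructure.omega3,
    F.metric_comm p _ (F.deltaY p X)]
  ring

end CartanEndo

/-- The second derivative of a composition with an affine map. -/
lemma fderiv_fderiv_comp_affine {E E' G : Type*} [NormedAddCommGroup E] [NormedSpace ℝ E]
    [NormedAddCommGroup E'] [NormedSpace ℝ E'] [NormedAddCommGroup G] [NormedSpace ℝ G]
    {f : E' → G} {c : E'} {A : E →L[ℝ] E'} {w : E} (hf : ContDiffAt ℝ 2 f (c + A w)) (v u : E) :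
    fderiv ℝ (fderiv ℝ fun z => f (c + A z)) w v u =
      fderiv ℝ (fderiv ℝ f) (c + A w) (A v) (A u) := by
  have ha : ∀ z, HasFDerivAt (fun z => c + A z) A z := fun z => A.hasFDerivAt.const_add c
  have e : (fderiv ℝ fun z => f (c + A z)) =ᶠ[𝓝 w] fun z => (fderiv ℝ f (c + A z)).comp A := by
    have h1 : ∀ᶠ y in 𝓝 (c + A w), ContDiffAt ℝ 2 f y := hf.eventually (by simp)
    filter_upwards [(ha w).continuousAt.eventually h1] with z hz
    exact ((hz.differentiableAt (by simp)).hasFDerivAt.comp z (ha z)).fderiv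
  have hd : DifferentiableAt ℝ (fderiv ℝ f) (c + A w) :=
    (hf.fderiv_right (m := 1) (by norm_num)).differentiableAt (by simp)
  rw [e.fderiv_eq]
  have := ((hd.hasFDerivAt.comp w (ha w)).clm_comp (hasFDerivAt_const A w)).fderiv
  simp only [Function.comp_def] at this
  rw [this]
  simp

/-! ### Smoothness of the section $l$ and of the metric -/

section Smoothness

variable {M : Type*} [TopologicalSpace M] [ChartedSpace Plane M] [IsManifold (𝓡 2) ∞ M]

/-- Smoothness of a section of `π^*TM` in terms of its components. -/
lemma contMDiffAt_section_iff_tangentCoord {n : ℕ∞ω} {p : SphereBundle M}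
    {s : Π q : SphereBundle M, PullbackTM M q} :
    ContMDiffAt 𝓘(ℝ, Plane × ℝ) (𝓘(ℝ, Plane × ℝ).prod 𝓘(ℝ, Plane)) n
      (fun q => (⟨q, s q⟩ : TotalSpace Plane (PullbackTM M))) p ↔
    ContMDiffAt 𝓘(ℝ, Plane × ℝ) 𝓘(ℝ, Plane) n
      (fun q => tangentCoord p.base q.base (s q)) p := by
  rw [contMDiffAt_section]
  apply Filter.EventuallyEq.contMDiffAt_iff
  filter_upwards [chart_source_mem_nhds (Plane × ℝ) p] with q hq
  have hq' : q.base ∈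
      (trivializationAt Plane (TangentSpace (𝓡 2) : M → Type) p.base).baseSet := by
    rw [TangentBundle.trivializationAt_baseSet]
    exact hq.1
  exact (Bundle.Trivialization.continuousLinearMapAt_apply_of_mem (R := ℝ)
    (trivializationAt Plane (TangentSpace (𝓡 2) : M → Type) p.base)
    hq' (s q)).symm

lemma contMDiffAt_chartAt_base (p : SphereBundle M) :
    ContMDiffAt 𝓘(ℝ, Plane × ℝ) 𝓘(ℝ, Plane) ∞ (fun q => chartAt Plane p.base q.base) p := by
  have h₁ : ContMDiffAt 𝓘(ℝ, Plane × ℝ) 𝓘(ℝ, Plane × ℝ) ∞ (chartAt (Plane × ℝ) p) p :=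
    (contMDiffOn_chart (x := p)).contMDiffAt (chart_source_mem_nhds _ p)
  have h₂ : ContMDiffAt 𝓘(ℝ, Plane × ℝ) 𝓘(ℝ, Plane) ∞ (fun z : Plane × ℝ => z.1)
    (chartAt (Plane × ℝ) p p) := contDiff_fst.contMDiff.contMDiffAt
  exact h₂.comp p h₁

/-- It replaces a vector on a ray by a positive multiple of the normalized representative $v_0 +
sJv_0$ used in the charts of $SM$. -/
lemma eq_smul_add_slopeRel_smul {v₀ w : Plane} (hv : v₀ ≠ 0) (hpos : 0 < inner ℝ v₀ w) :
    w = (inner ℝ v₀ w / ‖v₀‖ ^ 2) • (v₀ + slopeRel v₀ w • planeRot v₀) := by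
  have hn : ‖v₀‖ ^ 2 ≠ 0 := by simpa using hv
  have := plane_decomp v₀ w
  rw [smul_add, smul_smul, slopeRel, div_mul_div_comm, mul_comm (inner ℝ v₀ _),
    mul_div_mul_right _ _ hpos.ne', div_eq_inv_mul, div_eq_inv_mul, mul_smul, mul_smul,
    ← smul_add, ← this, smul_smul, inv_mul_cancel₀ hn, one_smul]

namespace FinslerStructure

variable (F : FinslerStructure M)

lemma sqFibre_unitVec (p : SphereBundle M) : F.sqFibre p.base (F.unitVec p) = 1 :=
  (congrArg (· ^ 2) (F.toFun_unitVec p)).trans (one_pow 2)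

lemma sqCoord_smul {x₀ x : M} (h : x ∈ (chartAt Plane x₀).source) {y : Plane} (hy : y ≠ 0) {r : ℝ}
    (hr : 0 < r) : F.sqCoord x₀ (chartAt Plane x₀ x, r • y) =
      r ^ 2 * F.sqCoord x₀ (chartAt Plane x₀ x, y) := by
  have h0 := tangentCoordSymm_ne_zero h hy
  have e : ∀ w, F.sqCoord x₀ (chartAt Plane x₀ x, w) = F.sqFibre x (tangentCoordSymm x₀ x w) := by
    intro w
    rw [F.sqFibre_eq h, tangentCoord_tangentCoordSymm h]
  rw [e, e, map_smul]
  exact (F.sqFibre_smul x _ h0 r hr).trans (by norm_num)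

lemma sqCoord_pos {x₀ x : M} (h : x ∈ (chartAt Plane x₀).source) {y : Plane} (hy : y ≠ 0) :
    0 < F.sqCoord x₀ (chartAt Plane x₀ x, y) := by
  have h0 := tangentCoordSymm_ne_zero h hy
  have := F.sqFibre_eq h (tangentCoordSymm x₀ x y)
  rw [tangentCoord_tangentCoordSymm h] at this
  rw [← this]
  exact pow_pos (F.pos x _ h0) 2

/-- The representative `someVector` of a ray is an arbitrary choice with no regularity in $q$. The
chart supplies a smooth representative $V(q) = v_0 + s(q)Jv_0$ instead, and $l = V / F(V)$ does not
depend on the choice. -/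
lemma contMDiffAt_tangentCoord_unitVec (p : SphereBundle M) :
    ContMDiffAt 𝓘(ℝ, Plane × ℝ) 𝓘(ℝ, Plane) ∞
      (fun q => tangentCoord p.base q.base (F.unitVec q)) p := by
  set v₀ : Plane := tangentCoord p.base p.base p.dir.someVector with hv₀
  have hv : v₀ ≠ 0 := tangentCoord_someVector_ne_zero p
  let V : SphereBundle M → Plane := fun q =>
    v₀ + slopeRel v₀ (tangentCoord p.base q.base q.dir.someVector) • planeRot v₀
  have hV0 : ∀ q, V q ≠ 0 := fun q => add_smul_planeRot_ne_zero hv _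
  have hV : ContMDiffAt 𝓘(ℝ, Plane × ℝ) 𝓘(ℝ, Plane) ∞ V p := by
    have h₁ : ContMDiffAt 𝓘(ℝ, Plane × ℝ) 𝓘(ℝ, Plane × ℝ) ∞ (chartAt (Plane × ℝ) p) p :=
      (contMDiffOn_chart (x := p)).contMDiffAt (chart_source_mem_nhds _ p)
    have h₂ : ContDiff ℝ ∞ (fun z : Plane × ℝ => v₀ + z.2 • planeRot v₀) := by fun_prop
    exact h₂.contMDiff.contMDiffAt.comp p h₁
  have hf : ContMDiffAt 𝓘(ℝ, Plane × ℝ) 𝓘(ℝ) ∞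
      (fun q => F.sqCoord p.base (chartAt Plane p.base q.base, V q)) p :=
    (F.contDiffAt_sqCoord (mem_chart_source Plane p.base) (hV0 p)).contMDiffAt.comp p
      ((contMDiffAt_chartAt_base p).prodMk_space hV)
  have hpos := F.sqCoord_pos (mem_chart_source Plane p.base) (hV0 p)
  have hc : ContMDiffAt 𝓘(ℝ, Plane × ℝ) 𝓘(ℝ) ∞
      (fun q => (√(F.sqCoord p.base (chartAt Plane p.base q.base, V q)))⁻¹) p := by
    have hg : ContDiffAt ℝ ∞ (fun r : ℝ => (√r)⁻¹)
        (F.sqCoord p.base (chartAt Plane p.base p.base, V p)) :=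
      (Real.contDiffAt_sqrt hpos.ne').inv (Real.sqrt_pos.2 hpos).ne'
    exact ContMDiffAt.comp (g := fun r : ℝ => (√r)⁻¹) p hg.contMDiffAt hf
  refine (hc.smul hV).congr_of_eventuallyEq ?_
  filter_upwards [chart_source_mem_nhds (Plane × ℝ) p] with q hq
  have hb : q.base ∈ (chartAt Plane p.base).source := hq.1
  have hi : 0 < inner ℝ v₀ (tangentCoord p.base q.base q.dir.someVector) := hq.2
  have hF := inv_pos.2 (F.toFun_someVector_pos q)
  set r : ℝ := (F.toFun ⟨q.base, q.dir.someVector⟩)⁻¹ *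
    (inner ℝ v₀ (tangentCoord p.base q.base q.dir.someVector) / ‖v₀‖ ^ 2) with hr
  have hrpos : 0 < r := mul_pos hF (div_pos hi (by have := norm_pos_iff.2 hv; positivity))
  have e : tangentCoord p.base q.base (F.unitVec q) = r • V q := by
    have h1 : tangentCoord p.base q.base (F.unitVec q) =
        (F.toFun ⟨q.base, q.dir.someVector⟩)⁻¹ •
          tangentCoord p.base q.base q.dir.someVector := map_smul _ _ _
    rw [h1, hr, mul_smul]
    exact congrArg _ (eq_smul_add_slopeRel_smul hv hi)
  -- Since $l = rV$ with $r > 0$, the normalization $F(l) = 1$ determines $r = 1/F(V)$.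
  have h1 : r ^ 2 * F.sqCoord p.base (chartAt Plane p.base q.base, V q) = 1 := by
    rw [← F.sqCoord_smul hb (hV0 q) hrpos, ← e]
    exact (F.sqFibre_eq hb (F.unitVec q)).symm.trans (F.sqFibre_unitVec q)
  have h2 : √(F.sqCoord p.base (chartAt Plane p.base q.base, V q)) = r⁻¹ := by
    rw [← Real.sqrt_sq (inv_pos.2 hrpos).le]
    congr 1
    rw [inv_pow]
    exact eq_inv_of_mul_eq_one_right h1
  simp only [Pi.smul_apply', h2, inv_inv, e]

/-- The distinguished section `l` is smooth. -/
lemma contMDiffAt_unitVec (p : SphereBundle M) :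
    ContMDiffAt 𝓘(ℝ, Plane × ℝ) (𝓘(ℝ, Plane × ℝ).prod 𝓘(ℝ, Plane)) ∞
      (fun q => (⟨q, F.unitVec q⟩ : TotalSpace Plane (PullbackTM M))) p :=
  contMDiffAt_section_iff_tangentCoord.2 (F.contMDiffAt_tangentCoord_unitVec p)

/-- The fibre embeds in the coordinate space by the affine map $w \mapsto (\varphi(x), Lw)$, so its
Hessian is the restriction of the full one to vertical directions. This shows how $g$ varies with
the base point. -/
lemma sqHessian_eq_sqCoord {x₀ x : M} (hx : x ∈ (chartAt Plane x₀).source) {L : Plane →L[ℝ] Plane}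
    (hL : L = tangentCoord x₀ x) {y : Plane} (hy : y ≠ 0) (u v : Plane) :
    F.sqHessian x y u v = fderiv ℝ (fderiv ℝ (F.sqCoord x₀)) (chartAt Plane x₀ x, L y)
      (0, L u) (0, L v) := by
  let A : Plane →L[ℝ] Plane × Plane := (ContinuousLinearMap.inr ℝ Plane Plane).comp L
  have hA : ∀ w : Plane, A w = (0, L w) := fun w => by simp [A]
  have ha : ∀ w : Plane, ((chartAt Plane x₀ x, 0) : Plane × Plane) + A w =
      (chartAt Plane x₀ x, L w) := fun w => by simp [A]
  have e : F.sqFibre x = fun w => F.sqCoord x₀ (((chartAt Plane x₀ x, 0) : Plane × Plane) + A w) := by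
    funext w
    rw [ha, hL]
    exact F.sqFibre_eq hx w
  have hLy : L y ≠ 0 := by
    rw [hL]
    exact tangentCoord_ne_zero hx hy
  have hc : ContDiffAt ℝ 2 (F.sqCoord x₀) (((chartAt Plane x₀ x, 0) : Plane × Plane) + A y) := by
    rw [ha]
    exact (F.contDiffAt_sqCoord hx hLy).of_le (by norm_cast)
  unfold sqHessian
  rw [e, fderiv_fderiv_comp_affine hc, ha, hA, hA]

/-- The metric in the coordinates of a chart of `M`. -/
lemma metric_eq_sqCoord {x₀ : M} {q : SphereBundle M} (hq : q.base ∈ (chartAt Plane x₀).source)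
    (u v : PullbackTM M q) : F.metric q u v = (1 / 2) *
      fderiv ℝ (fderiv ℝ (F.sqCoord x₀))
        (chartAt Plane x₀ q.base, tangentCoord x₀ q.base (F.unitVec q))
        (0, tangentCoord x₀ q.base v) (0, tangentCoord x₀ q.base u) :=
  (F.metric_eq q u v).trans
    (congrArg _ (F.sqHessian_eq_sqCoord hq rfl (F.unitVec_ne_zero q) v u))

/-- The metric is smooth. -/
lemma contMDiffAt_metric {p : SphereBundle M} {U V : Π q : SphereBundle M, PullbackTM M q}
    (hU : ContMDiffAt 𝓘(ℝ, Plane × ℝ) (𝓘(ℝ, Plane × ℝ).prod 𝓘(ℝ, Plane)) ∞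
      (fun q => (⟨q, U q⟩ : TotalSpace Plane (PullbackTM M))) p)
    (hV : ContMDiffAt 𝓘(ℝ, Plane × ℝ) (𝓘(ℝ, Plane × ℝ).prod 𝓘(ℝ, Plane)) ∞
      (fun q => (⟨q, V q⟩ : TotalSpace Plane (PullbackTM M))) p) :
    ContMDiffAt 𝓘(ℝ, Plane × ℝ) 𝓘(ℝ) ∞ (fun q => F.metric q (U q) (V q)) p := by
  have hp := mem_chart_source Plane p.base
  rw [contMDiffAt_section_iff_tangentCoord] at hU hV
  have hf : ContDiffAt ℝ ∞ (fderiv ℝ (fderiv ℝ (F.sqCoord p.base)))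
      (chartAt Plane p.base p.base, tangentCoord p.base p.base (F.unitVec p)) :=
    ((F.contDiffAt_sqCoord hp (tangentCoord_ne_zero hp (F.unitVec_ne_zero p))).fderiv_right
      (m := ∞) (by norm_cast)).fderiv_right (by norm_cast)
  have hc : ContMDiffAt 𝓘(ℝ, Plane × ℝ) 𝓘(ℝ, Plane × Plane →L[ℝ] Plane × Plane →L[ℝ] ℝ) ∞
      (fun q : SphereBundle M => fderiv ℝ (fderiv ℝ (F.sqCoord p.base))
        (chartAt Plane p.base q.base, tangentCoord p.base q.base (F.unitVec q))) p :=
    hf.contMDiffAt.comp p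
      ((contMDiffAt_chartAt_base p).prodMk_space (F.contMDiffAt_tangentCoord_unitVec p))
  have h0 : ContMDiffAt 𝓘(ℝ, Plane × ℝ) 𝓘(ℝ, Plane) ∞ (fun _ : SphereBundle M => (0 : Plane)) p :=
    contMDiffAt_const
  have h1 : ContMDiffAt 𝓘(ℝ, Plane × ℝ) 𝓘(ℝ) ∞ (fun _ : SphereBundle M => (1 / 2 : ℝ)) p :=
    contMDiffAt_const
  have h := h1.smul ((hc.clm_apply (h0.prodMk_space hV)).clm_apply
      (h0.prodMk_space hU))
  refine h.congr_of_eventuallyEq ?_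
  filter_upwards [chart_source_mem_nhds (Plane × ℝ) p] with q hq
  exact F.metric_eq_sqCoord hq.1 (U q) (V q)

end FinslerStructure
end Smoothness

/-! ### Coordinate vector fields on a manifold -/

lemma lieBracketWithin_eq_zero_of_eventuallyEq_const {E : Type*} [NormedAddCommGroup E]
    [NormedSpace ℝ E] {V W : E → E} {z v w : E} (hV : V =ᶠ[𝓝 z] fun _ => v)
    (hW : W =ᶠ[𝓝 z] fun _ => w) : VectorField.lieBracketWithin ℝ V W univ z = 0 := by
  rw [VectorField.lieBracketWithin_univ, VectorField.lieBracket_eq]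
  simp [hV.fderiv_eq, hW.fderiv_eq]

section CoordinateFields

variable {E : Type*} [NormedAddCommGroup E] [NormedSpace ℝ E]
  {N : Type*} [TopologicalSpace N] [ChartedSpace E N] [IsManifold 𝓘(ℝ, E) ∞ N]

/-- The components of a tangent vector at `q` in the preferred chart at `p`. -/
def coordVec (p : N) {q : N} (X : TangentSpace 𝓘(ℝ, E) q) : E :=
  mfderiv 𝓘(ℝ, E) 𝓘(ℝ, E) (extChartAt 𝓘(ℝ, E) p) q X

/-- The vector field near `p` that has constant components in the preferred chart at `p`. -/
abbrev coordField {p : N} (X : TangentSpace 𝓘(ℝ, E) p) : Π q : N, TangentSpace 𝓘(ℝ, E) q :=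
  FiberBundle.extend E X

lemma mdifferentiableAt_extChartAt_symm {p : N} {z : E}
    (hz : z ∈ (extChartAt 𝓘(ℝ, E) p).target) :
    MDifferentiableAt 𝓘(ℝ, E) 𝓘(ℝ, E) (extChartAt 𝓘(ℝ, E) p).symm z := by
  have : IsManifold 𝓘(ℝ, E) 1 N := IsManifold.of_le (n := ∞) (by norm_cast)
  rw [← mdifferentiableWithinAt_univ, ← ModelWithCorners.range_eq_univ 𝓘(ℝ, E)]
  exact mdifferentiableWithinAt_extChartAt_symm hz

/-- The derivative of a function on a manifold, in a chart. -/
lemma mvfderiv_apply_eq_fderiv {g : N → ℝ} {p q : N} (hq : q ∈ (chartAt E p).source)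
    (hg : MDifferentiableAt 𝓘(ℝ, E) 𝓘(ℝ) g q) (X : TangentSpace 𝓘(ℝ, E) q) :
    mvfderiv 𝓘(ℝ, E) g q X = fderiv ℝ (g ∘ (extChartAt 𝓘(ℝ, E) p).symm)
      (extChartAt 𝓘(ℝ, E) p q)
      (coordVec (E := E) p X) := by
  set φ := extChartAt 𝓘(ℝ, E) p
  have hφ : MDifferentiableAt 𝓘(ℝ, E) 𝓘(ℝ, E) φ q := mdifferentiableAt_extChartAt hq
  have hqs : q ∈ φ.source := by simpa [φ] using hq
  have hψ : MDifferentiableAt 𝓘(ℝ, E) 𝓘(ℝ, E) φ.symm (φ q) :=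
    mdifferentiableAt_extChartAt_symm (φ.map_source hqs)
  have hg' : MDifferentiableAt 𝓘(ℝ, E) 𝓘(ℝ) (g ∘ φ.symm) (φ q) := by
    refine MDifferentiableAt.comp (φ q) ?_ hψ
    rwa [φ.left_inv hqs]
  have e : g =ᶠ[𝓝 q] (g ∘ φ.symm) ∘ φ := by
    filter_upwards [(chartAt E p).open_source.mem_nhds hq] with r hr
    have hr' : r ∈ φ.source := by simpa [φ] using hr
    simp [φ.left_inv hr']
  have h1 : mfderiv 𝓘(ℝ, E) 𝓘(ℝ) g q = (mfderiv 𝓘(ℝ, E) 𝓘(ℝ) (g ∘ φ.symm) (φ q)).comp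
      (mfderiv 𝓘(ℝ, E) 𝓘(ℝ, E) φ q) := by
    rw [e.mfderiv_eq]
    exact mfderiv_comp q hg' hφ
  have h2 := congrArg (fun T => T X) h1
  rw [mfderiv_eq_fderiv] at h2
  exact h2

/-- The extension is constant in the trivialization of the tangent bundle at $p$, which is the
derivative of the chart; hence it is the pushforward of a constant field. -/
lemma coordField_eq_mfderiv_symm {p q : N} (hq : q ∈ (chartAt E p).source)
    (Y : TangentSpace 𝓘(ℝ, E) p) :
    coordField Y q =
      mfderivWithin 𝓘(ℝ, E) 𝓘(ℝ, E) (extChartAt 𝓘(ℝ, E) p).symm (range 𝓘(ℝ, E))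
        (extChartAt 𝓘(ℝ, E) p q)
        (coordVec (E := E) p Y) := by
  have : IsManifold 𝓘(ℝ, E) 1 N := IsManifold.of_le (n := ∞) (by norm_cast)
  have h := congrArg (fun T => T (trivializationAt E (TangentSpace 𝓘(ℝ, E) : N → Type _) p ⟨p, Y⟩).2)
    (TangentBundle.symmL_trivializationAt (I := 𝓘(ℝ, E)) hq)
  have h' := congrArg (fun T => T Y)
    (TangentBundle.continuousLinearMapAt_trivializationAt (I := 𝓘(ℝ, E)) (mem_chart_source E p))
  have hq' : q ∈ (trivializationAt E (TangentSpace 𝓘(ℝ, E) : N → Type _) p).baseSet := by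
    rwa [TangentBundle.trivializationAt_baseSet]
  have hp' : p ∈ (trivializationAt E (TangentSpace 𝓘(ℝ, E) : N → Type _) p).baseSet := by
    rw [TangentBundle.trivializationAt_baseSet]
    exact mem_chart_source E p
  have h1 := Bundle.Trivialization.continuousLinearMapAt_apply_of_mem (R := ℝ) _ hp' Y
  have h2 := Bundle.Trivialization.symmL_apply (R := ℝ) _ hq'
    (trivializationAt E (TangentSpace 𝓘(ℝ, E) : N → Type _) p ⟨p, Y⟩).2
  refine (h2.symm.trans h).trans (congrArg _ ?_)
  exact h1.symm.trans h'

lemma coordVec_coordField {p q : N} (hq : q ∈ (chartAt E p).source)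
    (Y : TangentSpace 𝓘(ℝ, E) p) :
    coordVec p (coordField Y q) = coordVec p Y := by
  have : IsManifold 𝓘(ℝ, E) 1 N := IsManifold.of_le (n := ∞) (by norm_cast)
  rw [coordField_eq_mfderiv_symm hq, coordVec]
  have h := mfderiv_extChartAt_comp_mfderivWithin_extChartAt_symm' (I := 𝓘(ℝ, E)) (x := p) (y := q)
    (by simpa using hq)
  exact congrArg (fun T => T (coordVec (E := E) p Y)) h

/-- Pulled back to the chart, both fields are constant near the image of $p$. This removes the
bracket term from the curvature. -/
lemma mlieBracket_coordField [CompleteSpace E] (p : N) (X Y : TangentSpace 𝓘(ℝ, E) p) :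
    VectorField.mlieBracket 𝓘(ℝ, E)
      (coordField X)
      (coordField Y) p = 0 := by
  have : IsManifold 𝓘(ℝ, E) 1 N := IsManifold.of_le (n := ∞) (by norm_cast)
  have key : ∀ Z : TangentSpace 𝓘(ℝ, E) p, (VectorField.mpullbackWithin 𝓘(ℝ, E) 𝓘(ℝ, E)
      (extChartAt 𝓘(ℝ, E) p).symm
      (coordField Z) (range 𝓘(ℝ, E)) :
        E → E) =ᶠ[𝓝 (extChartAt 𝓘(ℝ, E) p p)]
      fun _ => (coordVec (E := E) p Z) := by
    intro Z
    filter_upwards [extChartAt_target_mem_nhds (I := 𝓘(ℝ, E)) p] with z hz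
    have hs := (extChartAt 𝓘(ℝ, E) p).map_target hz
    have h1 := coordField_eq_mfderiv_symm (q := (extChartAt 𝓘(ℝ, E) p).symm z)
      (by simpa using hs) Z
    rw [(extChartAt 𝓘(ℝ, E) p).right_inv hz] at h1
    have hi := isInvertible_mfderivWithin_extChartAt_symm (I := 𝓘(ℝ, E)) hz
    rw [VectorField.mpullbackWithin_apply, h1]
    exact hi.inverse_apply_self _
  rw [← VectorField.mlieBracketWithin_univ, VectorField.mlieBracketWithin_apply, preimage_univ,
    univ_inter, ModelWithCorners.range_eq_univ]
  rw [ModelWithCorners.range_eq_univ] at key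
  exact (congrArg _ (lieBracketWithin_eq_zero_of_eventuallyEq_const (key X) (key Y))).trans
    (map_zero _)

/-- The derivative of a smooth function along a coordinate field is a smooth function, and
coordinate fields commute. -/
lemma mvfderiv_coordField_eventuallyEq {g : N → ℝ} {p : N}
    (hg : ∀ᶠ q in 𝓝 p, MDifferentiableAt 𝓘(ℝ, E) 𝓘(ℝ) g q) (Y : TangentSpace 𝓘(ℝ, E) p) :
    (fun q => mvfderiv 𝓘(ℝ, E) g q
      (coordField Y q)) =ᶠ[𝓝 p]
    (fun z => fderiv ℝ (g ∘ (extChartAt 𝓘(ℝ, E) p).symm) z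
      (coordVec (E := E) p Y)) ∘ extChartAt 𝓘(ℝ, E) p := by
  filter_upwards [hg, chart_source_mem_nhds E p] with q hq hqs
  rw [mvfderiv_apply_eq_fderiv hqs hq, coordVec_coordField hqs]
  rfl

lemma contDiffAt_comp_extChartAt_symm {g : N → ℝ} {p : N} {n : ℕ∞ω} (hn : n ≤ ∞)
    (hg : ContMDiffAt 𝓘(ℝ, E) 𝓘(ℝ) n g p) :
    ContDiffAt ℝ n (g ∘ (extChartAt 𝓘(ℝ, E) p).symm) (extChartAt 𝓘(ℝ, E) p p) := by
  have : IsManifold 𝓘(ℝ, E) n N := IsManifold.of_le (n := ∞) hn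
  rw [← contMDiffAt_iff_contDiffAt]
  refine ContMDiffAt.comp _ (by simpa using hg) ?_
  exact (contMDiffOn_extChartAt_symm p).contMDiffAt (extChartAt_target_mem_nhds p)

lemma mdifferentiableAt_mvfderiv_coordField {g : N → ℝ} {p : N}
    (hg : ContMDiffAt 𝓘(ℝ, E) 𝓘(ℝ) 2 g p) (Y : TangentSpace 𝓘(ℝ, E) p) :
    MDifferentiableAt 𝓘(ℝ, E) 𝓘(ℝ) (fun q => mvfderiv 𝓘(ℝ, E) g q
      (coordField Y q)) p := by
  have : IsManifold 𝓘(ℝ, E) 2 N := IsManifold.of_le (n := ∞) (by norm_cast)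
  have : IsManifold 𝓘(ℝ, E) 1 N := IsManifold.of_le (n := ∞) (by norm_cast)
  have hev : ∀ᶠ q in 𝓝 p, MDifferentiableAt 𝓘(ℝ, E) 𝓘(ℝ) g q :=
    ((contMDiffAt_iff_contMDiffAt_nhds (by simp)).1 hg).mono fun q hq => hq.mdifferentiableAt (by simp)
  refine MDifferentiableAt.congr_of_eventuallyEq ?_ (mvfderiv_coordField_eventuallyEq hev Y)
  refine MDifferentiableAt.comp p ?_ (mdifferentiableAt_extChartAt (mem_chart_source E p))
  rw [mdifferentiableAt_iff_differentiableAt]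
  exact (((contDiffAt_comp_extChartAt_symm (by norm_cast) hg).fderiv_right (m := 1)
    (by norm_num)).differentiableAt (by simp)).clm_apply (differentiableAt_const _)

/-- Both sides are the second derivative of $g$ read in the chart, so this is Schwarz's theorem. -/
lemma mvfderiv_mvfderiv_coordField_comm {g : N → ℝ} {p : N}
    (hg : ContMDiffAt 𝓘(ℝ, E) 𝓘(ℝ) 2 g p) (X Y : TangentSpace 𝓘(ℝ, E) p) :
    mvfderiv 𝓘(ℝ, E) (fun q => mvfderiv 𝓘(ℝ, E) g q
      (coordField Y q)) p X =
    mvfderiv 𝓘(ℝ, E) (fun q => mvfderiv 𝓘(ℝ, E) g q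
      (coordField X q)) p Y := by
  have : IsManifold 𝓘(ℝ, E) 2 N := IsManifold.of_le (n := ∞) (by norm_cast)
  have hc := contDiffAt_comp_extChartAt_symm (by norm_cast) hg
  have hev : ∀ᶠ q in 𝓝 p, MDifferentiableAt 𝓘(ℝ, E) 𝓘(ℝ) g q :=
    ((contMDiffAt_iff_contMDiffAt_nhds (by simp)).1 hg).mono fun q hq => hq.mdifferentiableAt (by simp)
  have hd : DifferentiableAt ℝ (fderiv ℝ (g ∘ (extChartAt 𝓘(ℝ, E) p).symm))
      (extChartAt 𝓘(ℝ, E) p p) :=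
    (hc.fderiv_right (m := 1) (by norm_num)).differentiableAt (by simp)
  have key : ∀ X Y : TangentSpace 𝓘(ℝ, E) p,
      mvfderiv 𝓘(ℝ, E) (fun q => mvfderiv 𝓘(ℝ, E) g q
        (coordField Y q)) p X =
      fderiv ℝ (fderiv ℝ (g ∘ (extChartAt 𝓘(ℝ, E) p).symm)) (extChartAt 𝓘(ℝ, E) p p)
        (coordVec (E := E) p X)
        (coordVec (E := E) p Y) := by
    intro X Y
    rw [mvfderiv_apply_eq_fderiv (mem_chart_source E p) (mdifferentiableAt_mvfderiv_coordField hg Y)]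
    have e : (fun q => mvfderiv 𝓘(ℝ, E) g q
        (coordField Y q)) ∘
          (extChartAt 𝓘(ℝ, E) p).symm =ᶠ[𝓝 (extChartAt 𝓘(ℝ, E) p p)]
        fun z => fderiv ℝ (g ∘ (extChartAt 𝓘(ℝ, E) p).symm) z
          (coordVec (E := E) p Y) := by
      have ht : Filter.Tendsto (extChartAt 𝓘(ℝ, E) p).symm (𝓝 (extChartAt 𝓘(ℝ, E) p p)) (𝓝 p) := by
        have := continuousAt_extChartAt_symm (I := 𝓘(ℝ, E)) p
        rwa [ContinuousAt, extChartAt_to_inv] at this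
      filter_upwards [ht.eventually (mvfderiv_coordField_eventuallyEq hev Y),
        extChartAt_target_mem_nhds (I := 𝓘(ℝ, E)) p] with z hz hzt
      simp only [Function.comp_apply] at hz ⊢
      rw [hz, (extChartAt 𝓘(ℝ, E) p).right_inv hzt]
    rw [e.fderiv_eq, fderiv_clm_apply hd (differentiableAt_const _)]
    simp
  rw [key, key]
  exact (hc.isSymmSndFDerivAt (by simp)) _ _

end CoordinateFields

/-- A family of linear maps on a finite-dimensional space is differentiable if its applications
are. -/
lemma differentiableAt_clm_of_apply {D E G : Type*} [NormedAddCommGroup D] [NormedSpace ℝ D]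
    [NormedAddCommGroup E] [NormedSpace ℝ E] [NormedAddCommGroup G] [NormedSpace ℝ G]
    [FiniteDimensional ℝ E] {f : D → E →L[ℝ] G} {x : D}
    (h : ∀ y, DifferentiableAt ℝ (fun x => f x y) x) : DifferentiableAt ℝ f x := by
  -- A basis identifies the space of linear maps with a finite power of $G$, where differentiability
  -- is componentwise.
  let d := Module.finrank ℝ E
  have hd : d = Module.finrank ℝ (Fin d → ℝ) := (Module.finrank_fin_fun ℝ).symm
  let e₁ := ContinuousLinearEquiv.ofFinrankEq hd
  let e₂ := (e₁.arrowCongr (1 : G ≃L[ℝ] G)).trans (ContinuousLinearEquiv.piRing (Fin d))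
  rw [← Function.id_comp f, ← e₂.symm_comp_self]
  exact e₂.symm.differentiableAt.comp x (differentiableAt_pi.mpr fun i => h _)

/-! ### The exterior derivative of a one-form through coordinate fields -/

section ExtDeriv

lemma exists_coordVec_eq {E : Type*} [NormedAddCommGroup E] [NormedSpace ℝ E]
    {N : Type*} [TopologicalSpace N] [ChartedSpace E N] [IsManifold 𝓘(ℝ, E) ∞ N] (p : N) (w : E) :
    ∃ Y : TangentSpace 𝓘(ℝ, E) p, coordVec (E := E) p Y = w := by
  have : IsManifold 𝓘(ℝ, E) 1 N := IsManifold.of_le (n := ∞) (by norm_cast)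
  have h := mfderiv_extChartAt_comp_mfderivWithin_extChartAt_symm' (I := 𝓘(ℝ, E)) (x := p) (y := p)
    (by simp)
  exact ⟨_, congrArg (fun T => T w) h⟩

variable {M : Type*} [TopologicalSpace M] [ChartedSpace Plane M] [IsManifold (𝓡 2) ∞ M]

/-- The exterior derivative of a one-form in terms of coordinate fields. -/
lemma extDerivOneForm_eq {α : Π q : SphereBundle M, TangentSpace 𝓘(ℝ, Plane × ℝ) q →L[ℝ] ℝ}
    {p : SphereBundle M} (hα : ∀ Y : TangentSpace 𝓘(ℝ, Plane × ℝ) p,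
      MDifferentiableAt 𝓘(ℝ, Plane × ℝ) 𝓘(ℝ) (fun q => α q (coordField Y q)) p)
    (X Y : TangentSpace 𝓘(ℝ, Plane × ℝ) p) :
    extDerivOneForm α p X Y =
      mvfderiv 𝓘(ℝ, Plane × ℝ) (fun q => α q (coordField Y q)) p X -
      mvfderiv 𝓘(ℝ, Plane × ℝ) (fun q => α q (coordField X q)) p Y := by
  let φ := extChartAt 𝓘(ℝ, Plane × ℝ) p
  let β : Plane × ℝ → Plane × ℝ →L[ℝ] ℝ := fun z =>
    (α (φ.symm z)).comp (mfderiv 𝓘(ℝ, Plane × ℝ) 𝓘(ℝ, Plane × ℝ) φ.symm z)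
  -- The form in the chart, applied to a constant vector, is $\alpha$ applied to the corresponding
  -- coordinate field.
  have hβ : ∀ Y : TangentSpace 𝓘(ℝ, Plane × ℝ) p,
      (fun z => β z (coordVec (E := Plane × ℝ) p Y)) =ᶠ[𝓝 (φ p)]
        (fun q => α q (coordField Y q)) ∘ φ.symm := by
    intro Y
    filter_upwards [extChartAt_target_mem_nhds (I := 𝓘(ℝ, Plane × ℝ)) p] with z hz
    have hs := φ.map_target hz
    have h1 := coordField_eq_mfderiv_symm (q := φ.symm z) (by simpa [φ] using hs) Y
    rw [ModelWithCorners.range_eq_univ, mfderivWithin_univ] at h1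
    have h2 : extChartAt 𝓘(ℝ, Plane × ℝ) p (φ.symm z) = z := φ.right_inv hz
    rw [h2] at h1
    exact (congrArg (α (φ.symm z)) h1).symm
  have hd : ∀ Y : TangentSpace 𝓘(ℝ, Plane × ℝ) p, DifferentiableAt ℝ
      ((fun q => α q (coordField Y q)) ∘ φ.symm) (φ p) := by
    intro Y
    rw [← mdifferentiableAt_iff_differentiableAt]
    refine MDifferentiableAt.comp (φ p) (I' := 𝓘(ℝ, Plane × ℝ)) ?_
      (mdifferentiableAt_extChartAt_symm (mem_extChartAt_target p))
    have h2 : φ.symm (φ p) = p := extChartAt_to_inv p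
    rw [h2]
    exact hα Y
  have hβd : DifferentiableAt ℝ β (φ p) := by
    refine differentiableAt_clm_of_apply fun w => ?_
    obtain ⟨Y, rfl⟩ := exists_coordVec_eq p w
    exact (hd Y).congr_of_eventuallyEq (hβ Y)
  have key : ∀ X Y : TangentSpace 𝓘(ℝ, Plane × ℝ) p,
      fderiv ℝ β (φ p) (coordVec (E := Plane × ℝ) p X) (coordVec (E := Plane × ℝ) p Y) =
      mvfderiv 𝓘(ℝ, Plane × ℝ) (fun q => α q (coordField Y q)) p X := by
    intro X Y
    rw [mvfderiv_apply_eq_fderiv (mem_chart_source _ p) (hα Y), ← (hβ Y).fderiv_eq,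
      fderiv_clm_apply hβd (differentiableAt_const _)]
    simp
  rw [← key, ← key]
  rfl

end ExtDeriv

/-! ### Local smooth orthonormal frames $(e, l)$ -/

section OrthonormalFrame

variable {M : Type*} [TopologicalSpace M] [ChartedSpace Plane M] [IsManifold (𝓡 2) ∞ M]

/-- Smoothness of a section of `π^*TM` at a point. -/
def SmoothSectionAt (s : Π q : SphereBundle M, PullbackTM M q) (p : SphereBundle M) : Prop :=
  ContMDiffAt 𝓘(ℝ, Plane × ℝ) (𝓘(ℝ, Plane × ℝ).prod 𝓘(ℝ, Plane)) ∞
    (fun q => (⟨q, s q⟩ : TotalSpace Plane (PullbackTM M))) p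

lemma SmoothSectionAt.mdifferentiableAt {s : Π q : SphereBundle M, PullbackTM M q}
    {p : SphereBundle M} (h : SmoothSectionAt s p) :
    MDifferentiableAt 𝓘(ℝ, Plane × ℝ) (𝓘(ℝ, Plane × ℝ).prod 𝓘(ℝ, Plane))
      (fun q => (⟨q, s q⟩ : TotalSpace Plane (PullbackTM M))) p :=
  ContMDiffAt.mdifferentiableAt h (by simp)

lemma exists_open_smoothSectionAt_extend {p : SphereBundle M} (u : PullbackTM M p) :
    ∃ U : Set (SphereBundle M), IsOpen U ∧ p ∈ U ∧
      ∀ q ∈ U, SmoothSectionAt (FiberBundle.extend Plane u) q := by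
  obtain ⟨s, hs, h⟩ := FiberBundle.exists_contMDiffOn_extend 𝓘(ℝ, Plane × ℝ) Plane (k := ∞) u
  obtain ⟨U, hU, ho, hp⟩ := mem_nhds_iff.1 hs
  exact ⟨U, ho, hp, fun q hq => (h.mono hU).contMDiffAt (ho.mem_nhds hq)⟩

namespace FinslerStructure

variable (F : FinslerStructure M)

lemma exists_ne_zero_orthogonal (p : SphereBundle M) :
    ∃ u : PullbackTM M p, u ≠ 0 ∧ F.metric p u (F.unitVec p) = 0 := by
  set l := F.unitVec p
  set a : Fin 2 → ℝ := fun i => F.metric p (stdBasis p i) l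
  -- With $a_i = g(b_i, l)$ for the standard basis $(b_i)$, the vector $(-a_1, a_0)$ is orthogonal
  -- to $l$. It vanishes only if both $a_i$ do, which would give $g(l,l) = 0$.
  refine ⟨-a 1 • stdBasis p 0 + a 0 • stdBasis p 1, fun h => ?_, ?_⟩
  · have hli := LinearIndependent.pair_iff.1 (show LinearIndependent ℝ
      ![stdBasis p 0, stdBasis p 1] by
        convert (stdBasis p).linearIndependent using 1
        ext i
        fin_cases i <;> rfl) _ _ h
    have h1 : F.metric p l l = ∑ i, stdCoord p i l * a i := by
      have := congrArg (F.metric p l) (sum_stdCoord_smul_stdBasis p l).symm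
      simpa only [map_sum, map_smul, smul_eq_mul, F.metric_comm p l (stdBasis p _)] using this
    rw [F.metric_unitVec_self, Fin.sum_univ_two, hli.2, neg_eq_zero.1 hli.1] at h1
    simp at h1
  · rw [F.metric_add_left, F.metric_smul_left, F.metric_smul_left]
    ring

/-- Local existence of smooth orthonormal frames `(e₁, l)` of `π^*TM`. -/
lemma exists_orthonormal_frame (p : SphereBundle M) :
    ∃ (V : Set (SphereBundle M)) (e : Π q : SphereBundle M, PullbackTM M q), IsOpen V ∧ p ∈ V ∧
      (∀ q ∈ V, SmoothSectionAt e q) ∧ (∀ q ∈ V, F.metric q (e q) (e q) = 1) ∧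
      ∀ q ∈ V, F.metric q (e q) (F.unitVec q) = 0 := by
  obtain ⟨u, hu, hul⟩ := F.exists_ne_zero_orthogonal p
  obtain ⟨U, ho, hp, hs⟩ := exists_open_smoothSectionAt_extend u
  set w : Π q : SphereBundle M, PullbackTM M q := FiberBundle.extend Plane u with hw
  have hwp : w p = u := FiberBundle.extend_apply_self Plane u
  -- Gram–Schmidt: the $l$-component is removed from a smooth extension of $u$, which does not
  -- change it at $p$.
  let c : SphereBundle M → ℝ := fun q => -F.metric q (w q) (F.unitVec q)
  let n : Π q : SphereBundle M, PullbackTM M q := w + c • F.unitVec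
  have hn : ∀ q ∈ U, SmoothSectionAt n q := fun q hq =>
    ContMDiffAt.add_section (hs q hq)
      (ContMDiffAt.smul_section (F.contMDiffAt_metric (hs q hq) (F.contMDiffAt_unitVec q)).neg
        (F.contMDiffAt_unitVec q))
  let m : SphereBundle M → ℝ := fun q => F.metric q (n q) (n q)
  have hm : ∀ q ∈ U, ContMDiffAt 𝓘(ℝ, Plane × ℝ) 𝓘(ℝ) ∞ m q := fun q hq =>
    F.contMDiffAt_metric (hn q hq) (hn q hq)
  have hmc : ContinuousOn m U := fun q hq => (hm q hq).continuousAt.continuousWithinAt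
  have hnl : ∀ q, F.metric q (n q) (F.unitVec q) = 0 := by
    intro q
    have : n q = w q + c q • F.unitVec q := rfl
    rw [this, F.metric_add_left, F.metric_smul_left, F.metric_unitVec_self]
    simp [c]
  have hnp : n p = u := by
    have : n p = w p + c p • F.unitVec p := rfl
    rw [this, hwp]
    simp [c, hwp, hul]
  -- The neighbourhood is shrunk to where $n$ has positive square norm, so that normalization is
  -- smooth.
  refine ⟨U ∩ m ⁻¹' Ioi 0, (fun q => (√(m q))⁻¹) • n, hmc.isOpen_inter_preimage ho isOpen_Ioi,
    ⟨hp, ?_⟩, ?_, ?_, ?_⟩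
  · change 0 < F.metric p (n p) (n p)
    rw [hnp]
    exact F.metric_pos p u hu
  · rintro q ⟨hq, hq0⟩
    have hq0 : 0 < m q := hq0
    have hg : ContDiffAt ℝ ∞ (fun r : ℝ => (√r)⁻¹) (m q) :=
      (Real.contDiffAt_sqrt hq0.ne').inv (Real.sqrt_pos.2 hq0).ne'
    exact ContMDiffAt.smul_section
      (ContMDiffAt.comp (g := fun r : ℝ => (√r)⁻¹) q hg.contMDiffAt (hm q hq)) (hn q hq)
  · rintro q ⟨-, hq0⟩
    have hq0 : 0 < m q := hq0
    have hr := Real.sqrt_pos.2 hq0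
    change F.metric q ((√(m q))⁻¹ • n q) ((√(m q))⁻¹ • n q) = 1
    rw [F.metric_smul_left, map_smul, smul_eq_mul]
    change (√(m q))⁻¹ * ((√(m q))⁻¹ * m q) = 1
    have := Real.mul_self_sqrt hq0.le
    field_simp
    rw [sq, this]
  · rintro q -
    change F.metric q ((√(m q))⁻¹ • n q) (F.unitVec q) = 0
    rw [F.metric_smul_left, hnl, mul_zero]

end FinslerStructure
end OrthonormalFrame

/-! ### Covariant derivatives in a frame -/

section ConnectionForms

variable {M : Type*} [TopologicalSpace M] [ChartedSpace Plane M] [IsManifold (𝓡 2) ∞ M]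

/-- Differentiability of a section of `π^*TM` at a point. -/
def MDiffSectionAt (s : Π q : SphereBundle M, PullbackTM M q) (p : SphereBundle M) : Prop :=
  MDifferentiableAt 𝓘(ℝ, Plane × ℝ) (𝓘(ℝ, Plane × ℝ).prod 𝓘(ℝ, Plane))
    (fun q => (⟨q, s q⟩ : TotalSpace Plane (PullbackTM M))) p

lemma MDiffSectionAt.smul_add_smul {e l : Π q : SphereBundle M, PullbackTM M q}
    {p : SphereBundle M} (he : MDiffSectionAt e p) (hl : MDiffSectionAt l p)
    {a b : SphereBundle M → ℝ} (ha : MDifferentiableAt 𝓘(ℝ, Plane × ℝ) 𝓘(ℝ) a p)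
    (hb : MDifferentiableAt 𝓘(ℝ, Plane × ℝ) 𝓘(ℝ) b p) :
    MDiffSectionAt (fun q => a q • e q + b q • l q) p :=
  mdifferentiableAt_add_section (MDifferentiableAt.smul_section ha he)
    (MDifferentiableAt.smul_section hb hl)

lemma MDiffSectionAt.congr {s s' : Π q : SphereBundle M, PullbackTM M q} {p : SphereBundle M}
    (hs : MDiffSectionAt s p) (h : ∀ᶠ q in 𝓝 p, s' q = s q) : MDiffSectionAt s' p :=
  MDifferentiableAt.congr_of_eventuallyEq hs (h.mono fun q hq =>
    congrArg (fun u => (⟨q, u⟩ : TotalSpace Plane (PullbackTM M))) hq)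

namespace CovariantDerivative

variable (D : PullbackConnection M)

lemma smul_add_smul_apply {e l : Π q : SphereBundle M, PullbackTM M q}
    {p : SphereBundle M} (he : MDiffSectionAt e p) (hl : MDiffSectionAt l p)
    {a b : SphereBundle M → ℝ} (ha : MDifferentiableAt 𝓘(ℝ, Plane × ℝ) 𝓘(ℝ) a p)
    (hb : MDifferentiableAt 𝓘(ℝ, Plane × ℝ) 𝓘(ℝ) b p) (X : TangentSpace 𝓘(ℝ, Plane × ℝ) p) :
    D (fun q => a q • e q + b q • l q) p X =
      (a p • D e p X + mvfderiv 𝓘(ℝ, Plane × ℝ) a p X • e p) +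
      (b p • D l p X + mvfderiv 𝓘(ℝ, Plane × ℝ) b p X • l p) := by
  have h := D.isCovariantDerivativeOnUniv
  have h1 := h.add (MDifferentiableAt.smul_section ha he) (MDifferentiableAt.smul_section hb hl)
    (mem_univ p)
  refine (congrArg (fun T => T X) h1).trans ?_
  have h2 := h.leibniz he ha (mem_univ p)
  have h3 := h.leibniz hl hb (mem_univ p)
  exact congrArg₂ (· + ·) (congrArg (fun T => T X) h2) (congrArg (fun T => T X) h3)

lemma congr_apply {s s' : Π q : SphereBundle M, PullbackTM M q}
    {p : SphereBundle M} (hs : MDiffSectionAt s p) (h : ∀ᶠ q in 𝓝 p, s' q = s q)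
    (X : TangentSpace 𝓘(ℝ, Plane × ℝ) p) : D s' p X = D s p X :=
  congrArg (fun T => T X) (D.isCovariantDerivativeOnUniv.congr_of_eventuallyEq
    (hs.congr h) hs Filter.univ_mem h)

/-- The covariant derivative of a linear combination of a frame `(e, l)` with
`∇e = α e + μ l`, `∇l = -μ e`. -/
lemma apply_frame {e l : Π q : SphereBundle M, PullbackTM M q}
    {p : SphereBundle M} (he : MDiffSectionAt e p) (hl : MDiffSectionAt l p)
    {a b : SphereBundle M → ℝ} (ha : MDifferentiableAt 𝓘(ℝ, Plane × ℝ) 𝓘(ℝ) a p)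
    (hb : MDifferentiableAt 𝓘(ℝ, Plane × ℝ) 𝓘(ℝ) b p)
    {s : Π q : SphereBundle M, PullbackTM M q} (hs : ∀ᶠ q in 𝓝 p, s q = a q • e q + b q • l q)
    {X : TangentSpace 𝓘(ℝ, Plane × ℝ) p} {α μ : ℝ} (hDe : D e p X = α • e p + μ • l p)
    (hDl : D l p X = -μ • e p) :
    D s p X = (mvfderiv 𝓘(ℝ, Plane × ℝ) a p X + α * a p - μ * b p) • e p +
      (mvfderiv 𝓘(ℝ, Plane × ℝ) b p X + μ * a p) • l p := by
  rw [D.congr_apply (he.smul_add_smul hl ha hb) hs, D.smul_add_smul_apply he hl ha hb, hDe, hDl]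
  module

end CovariantDerivative

/-- The covariant derivative of a smooth section along a coordinate field is smooth. -/
lemma smoothSectionAt_covariantDerivative {D : PullbackConnection M} {V : Set (SphereBundle M)}
    (hV : IsOpen V) (hD : ContMDiffCovariantDerivativeOn Plane ∞ D.toFun V)
    {s : Π q : SphereBundle M, PullbackTM M q} (hs : ∀ q ∈ V, SmoothSectionAt s q)
    {p : SphereBundle M} (hp : p ∈ V) (Y : TangentSpace 𝓘(ℝ, Plane × ℝ) p) :
    SmoothSectionAt (fun q => D s q (coordField Y q)) p := by
  have h1 := hD.contMDiff (σ := s) (fun q hq => ContMDiffAt.contMDiffWithinAt (hs q hq))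
  have h2 := h1.contMDiffAt (hV.mem_nhds hp)
  exact ContMDiffAt.clm_bundle_apply h2
    (FiberBundle.contMDiffAt_extend 𝓘(ℝ, Plane × ℝ) (Plane × ℝ) Y)

end ConnectionForms

/-! ### Connection forms and curvature in an orthonormal frame -/

section Curvature

variable {M : Type*} [TopologicalSpace M] [ChartedSpace Plane M] [IsManifold (𝓡 2) ∞ M]
  {F : FinslerStructure M}

namespace FinslerStructure

lemma metric_smul_add_smul_left {q : SphereBundle M} {e : PullbackTM M q}
    (h₁ : F.metric q e e = 1) (h₂ : F.metric q e (F.unitVec q) = 0) (a b : ℝ) :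
    F.metric q (a • e + b • F.unitVec q) e = a := by
  rw [F.metric_add_left, F.metric_smul_left, F.metric_smul_left, F.metric_comm q (F.unitVec q),
    h₁, h₂]
  ring

end FinslerStructure

/-- The Cartan endomorphism form has rank one, so that a two-form `R` enters the trace of its
product with `H` only through `g(R e₁, e₁)`. -/
lemma IsChernConnection.traceWedge_eq {D : PullbackConnection M} (hD : IsChernConnection F D)
    {p : SphereBundle M} {e₁ : PullbackTM M p} (h₁ : F.metric p e₁ e₁ = 1)
    (h₂ : F.metric p e₁ (F.unitVec p) = 0)
    (R : TangentSpace 𝓘(ℝ, Plane × ℝ) p → TangentSpace 𝓘(ℝ, Plane × ℝ) p →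
      PullbackTM M p →ₗ[ℝ] PullbackTM M p) (X Y Z : TangentSpace 𝓘(ℝ, Plane × ℝ) p) :
    traceWedge p (cartanEndo F D p) R X Y Z =
      wedgeOneTwo (cartanForm F D p) (fun X Y => F.metric p (R X Y e₁) e₁) X Y Z := by
  -- The composite $H(X) \circ T$ is the rank one map $u \mapsto \eta(X)\, g(Tu, e_1)\, e_1$, whose
  -- trace is read off at $u = e_1$.
  have key : ∀ (X : TangentSpace 𝓘(ℝ, Plane × ℝ) p) (T : PullbackTM M p →ₗ[ℝ] PullbackTM M p),
      LinearMap.trace ℝ (PullbackTM M p) (endoAt p (cartanEndo F D p) X ∘ₗ T) =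
        cartanForm F D p X * F.metric p (T e₁) e₁ := by
    intro X T
    let f : PullbackTM M p →ₗ[ℝ] ℝ :=
      cartanForm F D p X • ((F.metric p e₁ : PullbackTM M p →L[ℝ] ℝ).toLinearMap ∘ₗ T)
    have h : endoAt p (cartanEndo F D p) X ∘ₗ T = f.smulRight e₁ := by
      refine LinearMap.ext fun u => ?_
      refine (hD.cartanEndo_eq h₁ h₂ (T u) X).trans ?_
      rw [← hD.cartanForm_eq h₁ h₂, F.metric_comm]
      rfl
    have : Module.Free ℝ (PullbackTM M p) := inferInstanceAs (Module.Free ℝ Plane)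
    have : Module.Finite ℝ (PullbackTM M p) := inferInstanceAs (Module.Finite ℝ Plane)
    rw [h, LinearMap.trace_smulRight, F.metric_comm]
    rfl
  simp only [traceWedge, map_add, map_sub, key, wedgeOneTwo]

lemma mvfderiv_const_of_eventually {f : SphereBundle M → ℝ} {p : SphereBundle M} {c : ℝ}
    (h : ∀ᶠ q in 𝓝 p, f q = c) : mvfderiv 𝓘(ℝ, Plane × ℝ) f p = 0 :=
  (congrArg (fun T => (NormedSpace.fromTangentSpace c).toContinuousLinearMap.comp T)
    ((Filter.EventuallyEq.mfderiv_eq (f₁ := f) (f := fun _ => c) h).trans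
      mfderiv_const)).trans (ContinuousLinearMap.comp_zero _)

/-- The Chern connection in an orthonormal frame `(e, l)`. -/
lemma IsChernConnection.apply_frame {D : PullbackConnection M} (hD : IsChernConnection F D)
    {V : Set (SphereBundle M)} {e : Π q : SphereBundle M, PullbackTM M q} (hV : IsOpen V)
    (hes : ∀ q ∈ V, SmoothSectionAt e q) (hee : ∀ q ∈ V, F.metric q (e q) (e q) = 1)
    (hel : ∀ q ∈ V, F.metric q (e q) (F.unitVec q) = 0) {q : SphereBundle M} (hq : q ∈ V)
    (X : TangentSpace 𝓘(ℝ, Plane × ℝ) q) :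
    D e q X = -cartanForm F D q X • e q + F.metric q (D e q X) (F.unitVec q) • F.unitVec q ∧
      D F.unitVec q X = -F.metric q (D e q X) (F.unitVec q) • e q := by
  have he := (hes q hq).mdifferentiableAt
  have hl := SmoothSectionAt.mdifferentiableAt (F.contMDiffAt_unitVec q)
  have hVq := hV.mem_nhds hq
  have hll : F.cartanTensor q (e q) (F.unitVec q) (F.deltaY q X) = 0 := by
    rw [F.cartanTensor_swap_left, F.cartanTensor_unitVec_left]
  -- The inner products of the frame are constant, so almost metricity reads $-g(\nabla U, V) - g(U,
  -- \nabla V) = 2A(U, V, \delta y)$. The right side is $2\eta$ for $(e,e)$ and $0$ for the two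
  -- pairs containing $l$.
  have h1 := hD.almost_metric e e q he he X
  have h2 := hD.almost_metric e F.unitVec q he hl X
  have h3 := hD.almost_metric F.unitVec F.unitVec q hl hl X
  have d1 : mvfderiv 𝓘(ℝ, Plane × ℝ) (fun q => F.metric q (e q) (e q)) q = 0 :=
    mvfderiv_const_of_eventually (c := 1) (Filter.mem_of_superset hVq hee)
  have d2 : mvfderiv 𝓘(ℝ, Plane × ℝ) (fun q => F.metric q (e q) (F.unitVec q)) q = 0 :=
    mvfderiv_const_of_eventually (c := 0) (Filter.mem_of_superset hVq hel)
  have d3 : mvfderiv 𝓘(ℝ, Plane × ℝ) (fun q => F.metric q (F.unitVec q) (F.unitVec q)) q = 0 :=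
    mvfderiv_const_of_eventually (c := 1) (Filter.Eventually.of_forall F.metric_unitVec_self)
  rw [metricDeriv, d1, ← hD.cartanForm_eq (hee q hq) (hel q hq)] at h1
  rw [metricDeriv, d2, hll] at h2
  rw [metricDeriv, d3, F.cartanTensor_unitVec_left] at h3
  replace h1 : 0 - F.metric q (e q) (D e q X) - F.metric q (e q) (D e q X) = _ := h1
  replace h2 : 0 - F.metric q (F.unitVec q) (D e q X) - F.metric q (e q) (D F.unitVec q X) = _ := h2
  replace h3 : 0 - F.metric q (F.unitVec q) (D F.unitVec q X) -
    F.metric q (F.unitVec q) (D F.unitVec q X) = _ := h3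
  rw [F.metric_comm q (e q)] at h1 h2
  rw [F.metric_comm q (F.unitVec q)] at h2 h3
  have e1 : F.metric q (D e q X) (e q) = -cartanForm F D q X := by linarith
  have e2 : F.metric q (D F.unitVec q X) (e q) = -F.metric q (D e q X) (F.unitVec q) := by linarith
  have e3 : F.metric q (D F.unitVec q X) (F.unitVec q) = 0 := by linarith
  refine ⟨?_, ?_⟩
  · rw [← e1]
    exact F.eq_add_of_orthonormal (hee q hq) (hel q hq) _
  · have := F.eq_add_of_orthonormal (hee q hq) (hel q hq) (D F.unitVec q X)
    rwa [e2, e3, zero_smul, add_zero] at this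

/-- The component `g(R(X, Y) e, e)` of the curvature of a connection with `∇e = α e + μ l`,
`∇l = -μ e` in an orthonormal frame `(e, l)` is `dα(X, Y)`. -/
lemma metric_curvature_frame (D : PullbackConnection M) {V : Set (SphereBundle M)}
    {e : Π q : SphereBundle M, PullbackTM M q} (hV : IsOpen V)
    (hes : ∀ q ∈ V, SmoothSectionAt e q) (hee : ∀ q ∈ V, F.metric q (e q) (e q) = 1)
    (hel : ∀ q ∈ V, F.metric q (e q) (F.unitVec q) = 0)
    {α μ : Π q : SphereBundle M, TangentSpace 𝓘(ℝ, Plane × ℝ) q → ℝ}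
    (hDe : ∀ q ∈ V, ∀ X, D e q X = α q X • e q + μ q X • F.unitVec q)
    (hDl : ∀ q ∈ V, ∀ X, D F.unitVec q X = -μ q X • e q) {p : SphereBundle M} (hp : p ∈ V)
    (hα : ∀ Y : TangentSpace 𝓘(ℝ, Plane × ℝ) p,
      MDifferentiableAt 𝓘(ℝ, Plane × ℝ) 𝓘(ℝ) (fun q => α q (coordField Y q)) p)
    (hμ : ∀ Y : TangentSpace 𝓘(ℝ, Plane × ℝ) p,
      MDifferentiableAt 𝓘(ℝ, Plane × ℝ) 𝓘(ℝ) (fun q => μ q (coordField Y q)) p)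
    (X Y : TangentSpace 𝓘(ℝ, Plane × ℝ) p) :
    F.metric p (curvature D p X Y (e p)) (e p) =
      mvfderiv 𝓘(ℝ, Plane × ℝ) (fun q => α q (coordField Y q)) p X -
      mvfderiv 𝓘(ℝ, Plane × ℝ) (fun q => α q (coordField X q)) p Y := by
  let I := 𝓘(ℝ, Plane × ℝ)
  have hl : ∀ q, SmoothSectionAt F.unitVec q := fun q => F.contMDiffAt_unitVec q
  have hVp := hV.mem_nhds hp
  have self : ∀ Z : TangentSpace 𝓘(ℝ, Plane × ℝ) p, coordField Z p = Z :=
    fun Z => FiberBundle.extend_apply_self (Plane × ℝ) Z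
  -- The curvature is defined on the standard basis and extended linearly, so it is computed there
  -- first. The constant $C = -(d\mu + \alpha\wedge\mu)(X,Y)$ is $g(R(X,Y)l, e)$; it drops out at $u
  -- = e$ because $g(e, l) = 0$.
  obtain ⟨C, hC⟩ : ∃ C : ℝ, ∀ i, F.metric p (curvature D p X Y (stdBasis p i)) (e p) =
      (mvfderiv I (fun q => α q (coordField Y q)) p X -
        mvfderiv I (fun q => α q (coordField X q)) p Y) * F.metric p (stdBasis p i) (e p) +
      C * F.metric p (stdBasis p i) (F.unitVec p) := by
    refine ⟨mvfderiv I (fun q => μ q (coordField X q)) p Y -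
      mvfderiv I (fun q => μ q (coordField Y q)) p X - α p X * μ p Y + α p Y * μ p X, fun i => ?_⟩
    obtain ⟨U, hU, hpU, hσ⟩ := exists_open_smoothSectionAt_extend (stdBasis p i)
    change ∀ q ∈ U, SmoothSectionAt (localFrameAt p i) q at hσ
    set σ := localFrameAt p i with hσdef
    let a : SphereBundle M → ℝ := fun q => F.metric q (σ q) (e q)
    let b : SphereBundle M → ℝ := fun q => F.metric q (σ q) (F.unitVec q)
    have ha : ∀ q ∈ V ∩ U, ContMDiffAt I 𝓘(ℝ) ∞ a q := fun q hq =>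
      F.contMDiffAt_metric (hσ q hq.2) (hes q hq.1)
    have hb : ∀ q ∈ V ∩ U, ContMDiffAt I 𝓘(ℝ) ∞ b q := fun q hq =>
      F.contMDiffAt_metric (hσ q hq.2) (hl q)
    have hVU : V ∩ U ∈ 𝓝 p := (hV.inter hU).mem_nhds ⟨hp, hpU⟩
    have ha' : ∀ q ∈ V ∩ U, MDifferentiableAt I 𝓘(ℝ) a q := fun q hq =>
      (ha q hq).mdifferentiableAt (by simp)
    have hb' : ∀ q ∈ V ∩ U, MDifferentiableAt I 𝓘(ℝ) b q := fun q hq =>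
      (hb q hq).mdifferentiableAt (by simp)
    have ha2 : ContMDiffAt I 𝓘(ℝ) 2 a p := (ha p ⟨hp, hpU⟩).of_le (by norm_cast)
    have hb2 : ContMDiffAt I 𝓘(ℝ) 2 b p := (hb p ⟨hp, hpU⟩).of_le (by norm_cast)
    have hdec : ∀ q ∈ V, σ q = a q • e q + b q • F.unitVec q := fun q hq =>
      F.eq_add_of_orthonormal (hee q hq) (hel q hq) _
    let c (Z : TangentSpace 𝓘(ℝ, Plane × ℝ) p) (q : SphereBundle M) : ℝ :=
      mvfderiv I a q (coordField Z q) + α q (coordField Z q) * a q - μ q (coordField Z q) * b q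
    let d (Z : TangentSpace 𝓘(ℝ, Plane × ℝ) p) (q : SphereBundle M) : ℝ :=
      mvfderiv I b q (coordField Z q) + μ q (coordField Z q) * a q
    have hfirst : ∀ (Z : TangentSpace 𝓘(ℝ, Plane × ℝ) p), ∀ᶠ q in 𝓝 p,
        D σ q (coordField Z q) = c Z q • e q + d Z q • F.unitVec q := by
      intro Z
      filter_upwards [hVU] with q hq
      exact D.apply_frame (hes q hq.1).mdifferentiableAt (hl q).mdifferentiableAt (ha' q hq)
        (hb' q hq) (Filter.mem_of_superset (hV.mem_nhds hq.1) hdec) (hDe q hq.1 _)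
        (hDl q hq.1 _)
    have hap := ha' p ⟨hp, hpU⟩
    have hbp := hb' p ⟨hp, hpU⟩
    have hc : ∀ Z, MDifferentiableAt I 𝓘(ℝ) (c Z) p := fun Z =>
      ((mdifferentiableAt_mvfderiv_coordField ha2 Z).add ((hα Z).mul hap)).sub ((hμ Z).mul hbp)
    have hd : ∀ Z, MDifferentiableAt I 𝓘(ℝ) (d Z) p := fun Z =>
      (mdifferentiableAt_mvfderiv_coordField hb2 Z).add ((hμ Z).mul hap)
    have hdc : ∀ Z W : TangentSpace 𝓘(ℝ, Plane × ℝ) p, mvfderiv I (c Z) p W =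
        mvfderiv I (fun q => mvfderiv I a q (coordField Z q)) p W +
        (α p Z * mvfderiv I a p W + a p * mvfderiv I (fun q => α q (coordField Z q)) p W) -
        (μ p Z * mvfderiv I b p W + b p * mvfderiv I (fun q => μ q (coordField Z q)) p W) := by
      intro Z W
      have h1 := mvfderiv_fun_sub ((mdifferentiableAt_mvfderiv_coordField ha2 Z).add
        ((hα Z).mul hap)) ((hμ Z).mul hbp)
      have h2 := mvfderiv_fun_add (mdifferentiableAt_mvfderiv_coordField ha2 Z)
        ((hα Z).mul hap)
      have h3 := mvfderiv_fun_mul (hα Z) hap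
      have h4 := mvfderiv_fun_mul (hμ Z) hbp
      simp only [self] at h3 h4
      refine (congrArg (fun T => T W) h1).trans ?_
      refine congrArg₂ (· - ·) ((congrArg (fun T => T W) h2).trans ?_)
        (congrArg (fun T => T W) h4)
      exact congrArg₂ (· + ·) rfl (congrArg (fun T => T W) h3)
    have hsecond : ∀ Z W : TangentSpace 𝓘(ℝ, Plane × ℝ) p,
        F.metric p (D (fun q => D σ q (coordField Z q)) p W) (e p) =
          mvfderiv I (c Z) p W + α p W * c Z p - μ p W * d Z p := by
      intro Z W
      rw [D.apply_frame (hes p hp).mdifferentiableAt (hl p).mdifferentiableAt (hc Z) (hd Z)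
        (hfirst Z) (hDe p hp W) (hDl p hp W),
        F.metric_smul_add_smul_left (hee p hp) (hel p hp)]
    have hcurv : curvature D p X Y (stdBasis p i) =
        D (fun q => D σ q (coordField Y q)) p X - D (fun q => D σ q (coordField X q)) p Y := by
      rw [curvature, Module.Basis.constr_basis]
      have h0 := (congrArg (D σ p) (mlieBracket_coordField p X Y)).trans (map_zero _)
      exact (congrArg₂ (· - ·) rfl h0).trans (sub_zero _)
    -- Antisymmetrization in $X, Y$ cancels the second derivatives of $a$, the products of a first
    -- derivative with a connection form, and the terms $\alpha(X)\alpha(Y)$ and $\mu(X)\mu(Y)$.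
    rw [hcurv, F.metric_comm, map_sub, F.metric_comm, hsecond, F.metric_comm, hsecond, hdc, hdc,
      mvfderiv_mvfderiv_coordField_comm ha2 X Y]
    simp only [c, d, self]
    have e1 : F.metric p (stdBasis p i) (e p) = a p := by simp only [a, hσdef, localFrameAt_self]
    have e2 : F.metric p (stdBasis p i) (F.unitVec p) = b p := by
      simp only [b, hσdef, localFrameAt_self]
    rw [e1, e2]
    ring
  have hlin : ∀ u, F.metric p (curvature D p X Y u) (e p) =
      (mvfderiv I (fun q => α q (coordField Y q)) p X -
        mvfderiv I (fun q => α q (coordField X q)) p Y) * F.metric p u (e p) +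
      C * F.metric p u (F.unitVec p) := by
    intro u
    conv_lhs => rw [← sum_stdCoord_smul_stdBasis p u]
    conv_rhs => rw [← sum_stdCoord_smul_stdBasis p u]
    simp only [Fin.sum_univ_two, map_add, map_smul, F.metric_add_left, F.metric_smul_left, hC]
    ring
  rw [hlin, hee p hp, hel p hp]
  ring

end Curvature

/-! ### The path of connections between the Chern and Cartan connections -/

section Path

variable {M : Type*} [TopologicalSpace M] [ChartedSpace Plane M] [IsManifold (𝓡 2) ∞ M]
  {F : FinslerStructure M}

lemma connectionPath_apply (F : FinslerStructure M) (D : PullbackConnection M) (t : ℝ)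
    (s : Π q : SphereBundle M, PullbackTM M q) (q : SphereBundle M)
    (X : TangentSpace 𝓘(ℝ, Plane × ℝ) q) :
    connectionPath F D t s q X = D s q X + t • cartanEndo F D q (s q) X := by
  have h : connectionPath F D t s q X =
      (1 - t) • D s q X + (1 - (1 - t)) • (D s q X + cartanEndo F D q (s q) X) := rfl
  rw [h]
  module

/-- Adding $tH$ changes $-\eta$ to $(t-1)\eta$ in $\nabla e$ and leaves $\mu$ and $\nabla l$
untouched, so $g(R_t e, e) = (t-1)\,d\eta$ for every $t$. -/
lemma IsChernConnection.traceWedge_curvature {D : PullbackConnection M}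
    (hD : IsChernConnection F D) (t : ℝ) (p : SphereBundle M)
    (X Y Z : TangentSpace 𝓘(ℝ, Plane × ℝ) p) :
    traceWedge p (cartanEndo F D p) (curvature (connectionPath F D t) p) X Y Z =
      (t - 1) * wedgeOneTwo (cartanForm F D p) (extDerivOneForm (cartanForm F D) p) X Y Z := by
  obtain ⟨V, e, hV, hp, hes, hee, hel⟩ := F.exists_orthonormal_frame p
  have hl : ∀ q, SmoothSectionAt F.unitVec q := fun q => F.contMDiffAt_unitVec q
  let μ : Π q : SphereBundle M, TangentSpace 𝓘(ℝ, Plane × ℝ) q → ℝ :=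
    fun q X => F.metric q (D e q X) (F.unitVec q)
  have hD1 := fun q hq X => (hD.apply_frame hV hes hee hel (q := q) hq X).1
  have hD2 := fun q hq X => (hD.apply_frame hV hes hee hel (q := q) hq X).2
  have hsm := smoothSectionAt_covariantDerivative hV (hD.smooth V hV) hes hp
  have hμ : ∀ W : TangentSpace 𝓘(ℝ, Plane × ℝ) p,
      MDifferentiableAt 𝓘(ℝ, Plane × ℝ) 𝓘(ℝ) (fun q => μ q (coordField W q)) p := fun W =>
    (F.contMDiffAt_metric (hsm W) (hl p)).mdifferentiableAt (by simp)
  -- The definition of $\eta$ uses a different local frame at each point, which hides its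
  -- regularity; near $p$ it is recovered from $\eta(W) = -g(\nabla_W e, e)$ for the smooth section
  -- $e$.
  have hη : ∀ W : TangentSpace 𝓘(ℝ, Plane × ℝ) p, MDifferentiableAt 𝓘(ℝ, Plane × ℝ) 𝓘(ℝ)
      (fun q => cartanForm F D q (coordField W q)) p := by
    intro W
    refine ((F.contMDiffAt_metric (hsm W) (hes p hp)).mdifferentiableAt
      (by simp)).neg.congr_of_eventuallyEq ?_
    filter_upwards [hV.mem_nhds hp] with q hq
    have h := congrArg (fun u => F.metric q u (e q)) (hD1 q hq (coordField W q))
    rw [F.metric_smul_add_smul_left (hee q hq) (hel q hq)] at h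
    exact (neg_eq_iff_eq_neg.2 h).symm
  have hαt : ∀ W : TangentSpace 𝓘(ℝ, Plane × ℝ) p, MDifferentiableAt 𝓘(ℝ, Plane × ℝ) 𝓘(ℝ)
      (fun q => (t - 1) * cartanForm F D q (coordField W q)) p := fun W =>
    mdifferentiableAt_const.mul (hη W)
  have hdα : ∀ W W' : TangentSpace 𝓘(ℝ, Plane × ℝ) p, mvfderiv 𝓘(ℝ, Plane × ℝ)
      (fun q => (t - 1) * cartanForm F D q (coordField W q)) p W' =
      (t - 1) * mvfderiv 𝓘(ℝ, Plane × ℝ) (fun q => cartanForm F D q (coordField W q)) p W' := by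
    intro W W'
    have h := mvfderiv_fun_mul (mdifferentiableAt_const (c := t - 1)) (hη W)
    rw [mvfderiv_const, smul_zero, add_zero] at h
    exact congrArg (fun T => T W') h
  have hcurv : ∀ X Y : TangentSpace 𝓘(ℝ, Plane × ℝ) p,
      F.metric p (curvature (connectionPath F D t) p X Y (e p)) (e p) =
        (t - 1) * extDerivOneForm (cartanForm F D) p X Y := by
    intro X Y
    rw [metric_curvature_frame (connectionPath F D t) hV hes hee hel
      (α := fun q X => (t - 1) * cartanForm F D q X) (μ := μ) ?_ ?_ hp hαt hμ X Y, hdα, hdα,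
      extDerivOneForm_eq hη]
    · ring
    · intro q hq X
      rw [connectionPath_apply, hD.cartanEndo_eq (hee q hq) (hel q hq),
        ← hD.cartanForm_eq (hee q hq) (hel q hq), hee q hq, hD1 q hq X]
      simp only [μ]
      module
    · intro q hq X
      rw [connectionPath_apply, hD.cartanEndo_eq (hee q hq) (hel q hq), F.metric_comm,
        hel q hq, mul_zero, zero_smul, smul_zero, add_zero, hD2 q hq X]
  rw [hD.traceWedge_eq (hee p hp) (hel p hp)]
  simp only [wedgeOneTwo, hcurv]
  ring

end Path

end

/-! ### The main theorem -/

theorem theorem2 {M : Type*} [TopologicalSpace M] [ChartedSpace Plane M] [IsManifold (𝓡 2) ∞ M]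
    (F : FinslerStructure M) (D : PullbackConnection M) (hD : IsChernConnection F D)
    (p : SphereBundle M) :
    (∀ X Y Z : TangentSpace 𝓘(ℝ, Plane × ℝ) p,
      -2 * ∫ t in (0 : ℝ)..1,
          traceWedge p (cartanEndo F D p) (curvature (connectionPath F D t) p) X Y Z =
        wedgeOneTwo (cartanForm F D p) (extDerivOneForm (cartanForm F D) p) X Y Z) ∧
    (∀ e₁ : PullbackTM M p, F.metric p e₁ e₁ = 1 → F.metric p e₁ (F.unitVec p) = 0 →
      ∀ E₃ : TangentSpace 𝓘(ℝ, Plane × ℝ) p, solder p E₃ = 0 → F.omega3 p e₁ E₃ = 1 →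
      ∀ X : TangentSpace 𝓘(ℝ, Plane × ℝ) p,
        cartanForm F D p X =
          F.metric p (cartanEndo F D p e₁ E₃) e₁ * F.omega3 p e₁ X) := by
  refine ⟨fun X Y Z => ?_, fun e₁ h₁ h₂ E₃ _ h₃ X => ?_⟩
  · have hint : ∫ t in (0 : ℝ)..1, (t - 1) = -(1 / 2) := by
      rw [intervalIntegral.integral_sub (by simp) (by simp)]
      norm_num
    simp only [hD.traceWedge_curvature, intervalIntegral.integral_mul_const, hint]
    ring
  -- The coefficient $H_{111}$ is $A(e_1, e_1, \delta y(E_3)) = \eta(E_3) = -A_{111}\,\omega^3(E_3)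
  -- = -A_{111}$.
  · rw [hD.metric_cartanEndo, ← hD.cartanForm_eq h₁ h₂, hD.cartanForm_eq_omega3 h₁ h₂,
      hD.cartanForm_eq_omega3 h₁ h₂, h₃, mul_one]
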